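/- Let $G$ be a compact group with a compatible bi-invariant metric $d$ and normalized Haar measure $|\cdot|$. Write $1_\eta$ for the open ball of radius $\eta$ about the identity, $P_\eta=\mathbf 1_{1_\eta}/|1_\eta|$, and $f_\eta=f*P_\eta$, where $(f*g)(x)=\int_G f(y)g(y^{-1}x)\,dy$. Let $L\ge 1$, $C_0\ge 1$, $C_1\ge 1$, $d_0>0$, and assume: (i) $G$ is $L$-locally random with coefficient $C_0$: $\|\pi(x)-\pi(y)\|_{\mathrm{op}}\le C_0(\dim\pi)^L d(x,y)$ for every irreducible unitary representation $\pi$ of $G$ and all $x,y\in G$; (ii) $G$ satisfies the dimension condition: $C_1^{-1}\eta^{d_0}\le |1_\eta|\le C_1\eta^{d_0}$ for all $\eta\in(0,1)$. Fix $a\ge 4Ld_0$. A function $g\in L^2(G)$ is said to live at scale $\eta$ (with parameter $a$) if $$\|g_{\eta^{1/a}}\|_2\le \eta^{1/(2a)}\|g\|_2\quad\text{and}\quad \|g_{\eta^{a^2}}-g\|_2\le \eta^{a/2}\|g\|_2.$$ For an interval $I\subset\mathbb R$ let $\mathcal H_I\subset L^2(G)$ be the (Hilbert space) direct sum of the spaces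 $H_\pi$ spanned by the matrix coefficients of $\pi$, over the irreducible unitary representations $\pi$ of $G$ (up to equivalence) with $\dim\pi\in I$, and let $\pi_I:L^2(G)\to\mathcal H_I$ be the orthogonal projection. Then for every $0<\eta<1$: (1) If $f\in L^2(G)$ lives at scale $\eta$, then $$\|\pi_{I_\eta}(f)\|_2^2\ge \bigl(1-8\eta^{1/(2a)}\bigr)\|f\|_2^2,\qquad I_\eta=\Bigl[\tfrac1{2C_0}\eta^{-1/(La)},\;2C_1\eta^{-d_0a^2}\Bigr].$$ (2) Every $f\in\mathcal H_{I'_\eta}$ lives at scale $\eta$, where $$I'_\eta=\Bigl[C_1\eta^{-(d_0+1)/a},\;C_0^{-1/L}\eta^{(-2a^2+a)/(2L)}\Bigr].$$ -/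

import Mathlib

open MeasureTheory

noncomputable section

namespace LocRand

/-- A unitary representation of `G` on `H`: a homomorphism to the group of unitary operators of `H`
(the surjective linear isometries of `H`) whose action map `G × H → H` is continuous. -/
structure UnitaryRep (G : Type*) [Group G] [TopologicalSpace G]
    (H : Type*) [NormedAddCommGroup H] [InnerProductSpace ℂ H] where
  toHom : G →* (H ≃ₗᵢ[ℂ] H)
  continuous_action : Continuous fun p : G × H => toHom p.1 p.2

namespace UnitaryRep

variable {G : Type*} [Group G] [TopologicalSpace G]
  {H : Type*} [NormedAddCommGroup H] [InnerProductSpace ℂ H]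

/-- The operator `π(x)`, as an element of the normed space of bounded operators on `H`. -/
def op (π : UnitaryRep G H) (x : G) : H →L[ℂ] H :=
  (π.toHom x).toContinuousLinearEquiv.toContinuousLinearMap

/-- `π` is irreducible: `H ≠ 0`, and the only closed invariant subspaces are `0` and `H`. -/
def IsIrreducible (π : UnitaryRep G H) : Prop :=
  Nontrivial H ∧ ∀ W : Submodule ℂ H, IsClosed (W : Set H) →
    (∀ x : G, ∀ v ∈ W, π.toHom x v ∈ W) → W = ⊥ ∨ W = ⊤

/-- `H_π`: the subspace of `L²(G)` spanned by (the classes of) the matrix coefficients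
`x ↦ ⟨π(x) v, w⟩` of `π`. In Mathlib `inner ℂ` is conjugate-linear in the first argument. -/
def coeffSpace [MeasurableSpace G] (μ : Measure G) (π : UnitaryRep G H) :
    Submodule ℂ (Lp ℂ 2 μ) :=
  Submodule.span ℂ
    {g : Lp ℂ 2 μ | ∃ v w : H, g =ᵐ[μ] fun x : G => inner ℂ w (π.toHom x v)}

end UnitaryRep

/-- The metric of the compact group `G` is bi-invariant and `G` is `L`-locally random with
coefficient `C₀`: `‖π(x) - π(y)‖ ≤ C₀ (dim π)^L d(x, y)` for every irreducible unitary
representation `π` and all `x, y`. Irreducible unitary representations of compact groups are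
finite dimensional, so the finite-dimensional spaces in `Type` carry all of them up to
unitary equivalence. -/
structure IsLocallyRandom (G : Type*) [Group G] [MetricSpace G] (L C₀ : ℝ) : Prop where
  one_le_exponent : 1 ≤ L
  one_le_coefficient : 1 ≤ C₀
  dist_left : ∀ g x y : G, dist (g * x) (g * y) = dist x y
  dist_right : ∀ g x y : G, dist (x * g) (y * g) = dist x y
  norm_sub_le : ∀ (H : Type) [NormedAddCommGroup H] [InnerProductSpace ℂ H]
    [FiniteDimensional ℂ H] (π : UnitaryRep G H), π.IsIrreducible →
      ∀ x y : G, ‖π.op x - π.op y‖ ≤ C₀ * (Module.finrank ℂ H : ℝ) ^ L * dist x y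

section

variable {G : Type*} [Group G] [MetricSpace G] [MeasurableSpace G]

/-- The dimension condition `DC(C₁, d₀)`:
`C₁⁻¹ r^{d₀} ≤ |1_r| ≤ C₁ r^{d₀}` for all `r ∈ (0, 1)`, where `1_r` is the open ball of
radius `r` about the identity. -/
structure DimensionCondition (μ : Measure G) (C₁ d₀ : ℝ) : Prop where
  one_le_const : 1 ≤ C₁
  exponent_pos : 0 < d₀
  le_ball : ∀ r : ℝ, 0 < r → r < 1 → C₁⁻¹ * r ^ d₀ ≤ μ.real (Metric.ball (1 : G) r)
  ball_le : ∀ r : ℝ, 0 < r → r < 1 → μ.real (Metric.ball (1 : G) r) ≤ C₁ * r ^ d₀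

/-- Convolution `(f * g)(x) = ∫ f(y) g(y⁻¹ x) dy`. -/
def conv (μ : Measure G) (f g : G → ℂ) : G → ℂ :=
  fun x => ∫ y, f y * g (y⁻¹ * x) ∂μ

/-- `P_r`: the indicator function of the ball `1_r` divided by the measure of that ball. -/
def ballDensity (μ : Measure G) (r : ℝ) : G → ℂ :=
  (Metric.ball (1 : G) r).indicator fun _ => ((μ.real (Metric.ball (1 : G) r))⁻¹ : ℂ)

/-- `f_r = f * P_r`. -/
def avg (μ : Measure G) (f : G → ℂ) (r : ℝ) : G → ℂ :=
  conv μ f (ballDensity μ r)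

/-- `g ∈ L²(G)` lives at scale `η` (with parameter `a`). -/
structure LivesAtScale (μ : Measure G) (a η : ℝ) (g : Lp ℂ 2 μ) : Prop where
  averaging_to_zero :
    eLpNorm (avg μ g (η ^ (1 / a))) 2 μ ≤ ENNReal.ofReal (η ^ (1 / (2 * a)) * ‖g‖)
  almost_invariant :
    eLpNorm (avg μ g (η ^ (a ^ 2)) - (g : G → ℂ)) 2 μ ≤ ENNReal.ofReal (η ^ (a / 2) * ‖g‖)

/-- `𝓗_I`: the Hilbert space direct sum of the `H_π` over the irreducible `π` with `dim π ∈ I`,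
that is, the closed span of these subspaces of `L²(G)`. -/
def dimSpace (μ : Measure G) (I : Set ℝ) : Submodule ℂ (Lp ℂ 2 μ) :=
  (Submodule.span ℂ {g : Lp ℂ 2 μ | ∃ (H : Type) (_ : NormedAddCommGroup H)
    (_ : InnerProductSpace ℂ H) (_ : FiniteDimensional ℂ H) (π : UnitaryRep G H),
      π.IsIrreducible ∧ (Module.finrank ℂ H : ℝ) ∈ I ∧ g ∈ π.coeffSpace μ}).topologicalClosure

instance (μ : Measure G) (I : Set ℝ) : (dimSpace μ I).HasOrthogonalProjection := by
  unfold dimSpace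
  infer_instance

/-- `π_I : L²(G) → 𝓗_I`, the orthogonal projection, regarded as an operator on `L²(G)`. -/
def dimProj (μ : Measure G) (I : Set ℝ) : Lp ℂ 2 μ →L[ℂ] Lp ℂ 2 μ :=
  (dimSpace μ I).starProjection

end

end LocRand

end

/-! Bi-invariance makes `P_r` invariant under inversion and conjugation. So `∫ P_r(z) π(z) dz`
commutes with an irreducible `π`, and by Schur's lemma `f ↦ f * P_r` acts on `H_π` as a scalar `c`.
Two bounds on `c` carry the theorem. Local randomness gives `|c - 1| ≤ C₀ (dim π)^L r`, so low
dimensions are almost fixed. Cauchy-Schwarz between `P_r` and a matrix coefficient, with Schur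
orthogonality, gives `|c|² ≤ 1 / (|1_r| dim π)`, so high dimensions are almost killed
(`UnitaryRep.IsIrreducible.exists_coeffSpace_le_eigenspace`).

Averaging is self-adjoint, so bounds on the scalars become norm bounds on `dimSpace`; this gives (2)
by substituting the endpoints of the interval. For (1), Peter-Weyl (`dimSpace_univ`) splits `f`
orthogonally into low, middle and high dimensions. Averaging respects the splitting: a large low
part would survive at scale `η^(1/a)`, and a large high part would be visibly changed at scale
`η^(a²)`. Both parts are therefore small (`IsLocallyRandom.norm_sq_sub_le`). The numerical estimate
needs `a ≥ 1`, which comes from `L d₀ ≥ 1` (`IsLocallyRandom.one_le_exponent_mul`). -/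

noncomputable section

set_option linter.unusedSectionVars false

namespace LocRand

open Metric Filter Topology ComplexConjugate

/-! ### Algebra of unitary representations. -/

namespace UnitaryRep

variable {G : Type*} [Group G] [TopologicalSpace G]
  {H : Type*} [NormedAddCommGroup H] [InnerProductSpace ℂ H] (π : UnitaryRep G H)

theorem toHom_mul_apply (x y : G) (v : H) :
    π.toHom (x * y) v = π.toHom x (π.toHom y v) := by
  rw [map_mul]; rfl

@[simp]
theorem toHom_one_apply (v : H) : π.toHom 1 v = v := by
  rw [map_one]; rfl

@[simp]
theorem toHom_inv_apply_apply (x : G) (v : H) : π.toHom x⁻¹ (π.toHom x v) = v := by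
  rw [← toHom_mul_apply]; simp

@[simp]
theorem toHom_apply_inv_apply (x : G) (v : H) : π.toHom x (π.toHom x⁻¹ v) = v := by
  rw [← toHom_mul_apply]; simp

theorem inner_toHom_right (x : G) (v w : H) :
    inner ℂ v (π.toHom x w) = inner ℂ (π.toHom x⁻¹ v) w := by
  rw [← LinearIsometryEquiv.inner_map_map (π.toHom x⁻¹) v]; simp

theorem continuous_toHom_apply (v : H) : Continuous fun x => π.toHom x v :=
  π.continuous_action.comp (by fun_prop : Continuous fun x : G => (x, v))

theorem op_apply (x : G) (v : H) : π.op x v = π.toHom x v := rfl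

theorem op_mul (x y : G) : π.op (x * y) = (π.op x).comp (π.op y) := by
  ext v; exact π.toHom_mul_apply x y v

theorem op_one : π.op 1 = ContinuousLinearMap.id ℂ H := by
  ext v; exact π.toHom_one_apply v

end UnitaryRep

/-! ### Unimodularity of compact groups. -/

section HaarInvariance

variable {G : Type*} [Group G] [TopologicalSpace G] [IsTopologicalGroup G] [CompactSpace G]
  [MeasurableSpace G] [BorelSpace G] (μ : Measure G) [μ.IsHaarMeasure] [IsProbabilityMeasure μ]

theorem isMulRightInvariant_of_isProbabilityMeasure : μ.IsMulRightInvariant := by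
  refine ⟨fun g => ?_⟩
  have : IsProbabilityMeasure (μ.map (· * g)) :=
    Measure.isProbabilityMeasure_map (measurable_mul_const g).aemeasurable
  have : (μ.map (· * g)).IsHaarMeasure :=
    Measure.isHaarMeasure_map_mul_right μ g
  exact Measure.isHaarMeasure_eq_of_isProbabilityMeasure _ _

end HaarInvariance

/-! ### Symmetries of balls about the identity and of their densities. -/

section Ball

variable {G : Type*} [Group G] [MetricSpace G]

section

variable [IsIsometricSMul G G]

theorem inv_mem_ball_one {r : ℝ} {x : G} : x⁻¹ ∈ ball (1 : G) r ↔ x ∈ ball (1 : G) r := by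
  rw [mem_ball, mem_ball, ← dist_mul_left x x⁻¹ 1, dist_comm]; simp

/-- Translating on the left by `y` and cancelling `y` on the right gives `d(xy, 1) = d(yxy, y) =
d(yx, 1)`. Hence `P_r` is a class function. -/
theorem mul_comm_mem_ball_one [IsIsometricSMul Gᵐᵒᵖ G] {r : ℝ} {x y : G} :
    x * y ∈ ball (1 : G) r ↔ y * x ∈ ball (1 : G) r := by
  rw [mem_ball, mem_ball, ← dist_mul_left y (x * y) 1, ← dist_mul_right (y * x) 1 y]
  simp [mul_assoc]

end

variable [MeasurableSpace G] (μ : Measure G) (r : ℝ)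

theorem ballDensity_inv [IsIsometricSMul G G] (x : G) :
    ballDensity μ r x⁻¹ = ballDensity μ r x := by
  classical
  simp only [ballDensity, Set.indicator_apply, inv_mem_ball_one]

theorem ballDensity_mul_comm [IsIsometricSMul G G] [IsIsometricSMul Gᵐᵒᵖ G] (x y : G) :
    ballDensity μ r (x * y) = ballDensity μ r (y * x) := by
  classical
  simp only [ballDensity, Set.indicator_apply, mul_comm_mem_ball_one (x := x)]

theorem conj_ballDensity (x : G) : conj (ballDensity μ r x) = ballDensity μ r x := by
  classical
  rw [ballDensity, Set.indicator_apply]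
  split_ifs <;> simp

theorem ofReal_norm_ballDensity (x : G) :
    ((‖ballDensity μ r x‖ : ℝ) : ℂ) = ballDensity μ r x := by
  classical
  rw [ballDensity, Set.indicator_apply]
  split_ifs <;> simp

theorem norm_ballDensity_le (x : G) : ‖ballDensity μ r x‖ ≤ (μ.real (ball (1 : G) r))⁻¹ := by
  classical
  rw [ballDensity, Set.indicator_apply]
  split_ifs <;> simp [abs_of_nonneg]

end Ball

/-! ### Convolution with `P_r` as a compact self-adjoint operator on `L²(G)`. -/

section Avg

variable {G : Type*} [Group G] [MetricSpace G] [IsTopologicalGroup G]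
  [CompactSpace G] [MeasurableSpace G] [BorelSpace G] (μ : Measure G) [μ.IsHaarMeasure]
  [IsProbabilityMeasure μ] (r : ℝ)

theorem measurable_ballDensity : Measurable (ballDensity μ r) :=
  measurable_const.indicator measurableSet_ball

theorem integrable_ballDensity : Integrable (ballDensity μ r) μ :=
  (integrable_const _).indicator measurableSet_ball

variable {r} in
theorem measureReal_ball_one_pos (hr : 0 < r) : 0 < μ.real (ball (1 : G) r) :=
  ENNReal.toReal_pos (measure_ball_pos μ 1 hr).ne' (measure_ne_top _ _)

variable {r} in
theorem integral_ballDensity (hr : 0 < r) : ∫ z, ballDensity μ r z ∂μ = 1 := by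
  have := (measureReal_ball_one_pos μ hr).ne'
  rw [ballDensity, integral_indicator measurableSet_ball, setIntegral_const, Complex.real_smul]
  exact mul_inv_cancel₀ (by exact_mod_cast this)

variable {r} in
theorem integral_norm_ballDensity (hr : 0 < r) : ∫ z, ‖ballDensity μ r z‖ ∂μ = 1 := by
  have h := integral_ballDensity μ hr
  rw [← funext (ofReal_norm_ballDensity μ r)] at h
  exact Complex.ofReal_injective
    (((integral_ofReal (𝕜 := ℂ)).symm.trans h).trans Complex.ofReal_one.symm)

/-- The density of the ball of radius `r` about the identity, as an element of `L²`. -/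
def ballLp : Lp ℂ 2 μ :=
  indicatorConstLp 2 (measurableSet_ball (x := (1 : G)) (ε := r)) (measure_ne_top μ _)
    ((μ.real (ball (1 : G) r))⁻¹ : ℂ)

theorem coeFn_ballLp : ballLp μ r =ᵐ[μ] ballDensity μ r :=
  indicatorConstLp_coeFn

variable {r} in
theorem norm_ballLp_sq (hr : 0 < r) : ‖ballLp μ r‖ ^ 2 = (μ.real (ball (1 : G) r))⁻¹ := by
  have h := measureReal_ball_one_pos μ hr
  rw [ballLp, norm_indicatorConstLp (by norm_num) (by norm_num), mul_pow, ← Real.rpow_natCast,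
    ← Real.rpow_natCast, ← Real.rpow_mul h.le]
  simp only [norm_inv, Complex.norm_real, Real.norm_eq_abs, abs_of_pos h]
  norm_num
  field_simp

variable [μ.IsMulRightInvariant]

/-- The right regular representation, by `f ↦ f(· x)`, on `L²(G)`. -/
def rightRegular : UnitaryRep G (Lp ℂ 2 μ) where
  toHom :=
    { toFun := fun x =>
        { Lp.compMeasurePreservingₗᵢ ℂ (· * x) (measurePreserving_mul_right μ x) with
          invFun := Lp.compMeasurePreserving (· * x⁻¹) (measurePreserving_mul_right μ x⁻¹)
          left_inv := fun f => by
            refine Lp.ext ((Lp.coeFn_compMeasurePreserving _ _).trans ?_)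
            filter_upwards [(measurePreserving_mul_right μ x⁻¹).quasiMeasurePreserving.ae
              (Lp.coeFn_compMeasurePreserving f (measurePreserving_mul_right μ x))] with y hy
            exact hy.trans (by simp)
          right_inv := fun f => by
            refine Lp.ext ((Lp.coeFn_compMeasurePreserving _ _).trans ?_)
            filter_upwards [(measurePreserving_mul_right μ x).quasiMeasurePreserving.ae
              (Lp.coeFn_compMeasurePreserving f (measurePreserving_mul_right μ x⁻¹))] with y hy
            exact hy.trans (by simp) }
      map_one' := by
        ext1 f
        refine Lp.ext ((Lp.coeFn_compMeasurePreserving f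
          (measurePreserving_mul_right μ 1)).trans ?_)
        exact Eventually.of_forall fun y => by simp
      map_mul' := fun x y => by
        ext1 f
        refine Lp.ext ((Lp.coeFn_compMeasurePreserving f
          (measurePreserving_mul_right μ (x * y))).trans ?_)
        refine EventuallyEq.trans ?_ (Lp.coeFn_compMeasurePreserving _
          (measurePreserving_mul_right μ x)).symm
        filter_upwards [(measurePreserving_mul_right μ x).quasiMeasurePreserving.ae
              (Lp.coeFn_compMeasurePreserving f (measurePreserving_mul_right μ y))] with z hz
        exact Eq.trans (by simp [mul_assoc]) hz.symm }
  continuous_action := by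
    let g : C(G × Lp ℂ 2 μ, C(G, G)) :=
      (ContinuousMap.mk (fun a : G × G ↦ a.2 * a.1) (by fun_prop)).curry.comp ContinuousMap.fst
    exact continuous_snd.compMeasurePreservingLp g.continuous
      (fun p => measurePreserving_mul_right μ p.1) (by norm_num)

theorem coeFn_rightRegular (x : G) (f : Lp ℂ 2 μ) :
    (rightRegular μ).toHom x f =ᵐ[μ] fun y => f (y * x) :=
  Lp.coeFn_compMeasurePreserving f (measurePreserving_mul_right μ x)

theorem avg_congr_ae {f g : G → ℂ} (h : f =ᵐ[μ] g) : avg μ f r = avg μ g r := by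
  ext x
  refine integral_congr_ae ?_
  filter_upwards [h] with y hy
  rw [hy]

variable [IsIsometricSMul G G] [IsIsometricSMul Gᵐᵒᵖ G]

theorem avg_eq_integral_mul_left (f : G → ℂ) (x : G) :
    avg μ f r x = ∫ z, f (x * z) * ballDensity μ r z ∂μ := by
  rw [avg, conv, ← integral_mul_left_eq_self _ x]
  refine integral_congr_ae (Eventually.of_forall fun z => ?_)
  simp only [mul_inv_rev, inv_mul_cancel_right, ballDensity_inv]

/-- Since `P_r` is a class function, averaging on the left and on the right agree. -/
theorem avg_eq_integral_mul_right (f : G → ℂ) (x : G) :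
    avg μ f r x = ∫ z, f (z * x) * ballDensity μ r z ∂μ := by
  rw [avg, conv, ← integral_mul_right_eq_self _ x]
  refine integral_congr_ae (Eventually.of_forall fun z => ?_)
  simp only [mul_inv_rev, mul_assoc]
  rw [ballDensity_mul_comm, mul_inv_cancel_right, ballDensity_inv]

/-- Averages are matrix coefficients of the right regular representation. Continuity, equicontinuity
and the Peter-Weyl argument all rest on this form. -/
theorem avg_eq_inner (f : Lp ℂ 2 μ) (x : G) :
    avg μ f r x = inner ℂ (ballLp μ r) ((rightRegular μ).toHom x f) := by
  rw [avg_eq_integral_mul_right, L2.inner_def]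
  refine integral_congr_ae ?_
  filter_upwards [coeFn_ballLp μ r, coeFn_rightRegular μ x f] with z h1 h2
  rw [h1, h2, RCLike.inner_apply, conj_ballDensity]

/-- `f ↦ f * P_r`, as a map from `L²(G)` to the continuous functions. -/
def avgBCF : Lp ℂ 2 μ →L[ℂ] BoundedContinuousFunction G ℂ :=
  LinearMap.mkContinuous
    { toFun := fun f => BoundedContinuousFunction.mkOfCompact
        ⟨fun x => inner ℂ (ballLp μ r) ((rightRegular μ).toHom x f),
          Continuous.inner (𝕜 := ℂ) continuous_const ((rightRegular μ).continuous_toHom_apply f)⟩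
      map_add' := fun f g => by ext x; simp [inner_add_right]
      map_smul' := fun c f => by ext x; simp [inner_smul_right] }
    ‖ballLp μ r‖ (fun f => by
      refine (BoundedContinuousFunction.norm_le (by positivity)).2 fun x => ?_
      change ‖inner ℂ (ballLp μ r) ((rightRegular μ).toHom x f)‖ ≤ _
      refine (norm_inner_le_norm _ _).trans_eq ?_
      rw [LinearIsometryEquiv.norm_map])

theorem avgBCF_apply (f : Lp ℂ 2 μ) (x : G) : avgBCF μ r f x = avg μ f r x :=
  (avg_eq_inner μ r f x).symm

/-- `f ↦ f * P_r` as an operator on `L²(G)`. -/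
def avgOp : Lp ℂ 2 μ →L[ℂ] Lp ℂ 2 μ :=
  (BoundedContinuousFunction.toLp 2 μ ℂ).comp (avgBCF μ r)

theorem coeFn_avgOp (f : Lp ℂ 2 μ) : avgOp μ r f =ᵐ[μ] avg μ f r := by
  refine (BoundedContinuousFunction.coeFn_toLp 2 μ ℂ (avgBCF μ r f)).trans ?_
  exact Eventually.of_forall fun x => avgBCF_apply μ r f x

/-- Arzelà-Ascoli: averages of the unit ball of `L²` are bounded by `‖P_r‖₂`, and moving the
translation onto `P_r` yields a modulus of continuity independent of `f`. -/
theorem isCompactOperator_avgOp : IsCompactOperator (avgOp μ r) := by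
  suffices h : IsCompactOperator (avgBCF μ r) from
    h.clm_comp (BoundedContinuousFunction.toLp 2 μ ℂ)
  rw [isCompactOperator_iff_exists_mem_nhds_isCompact_closure_image]
  refine ⟨closedBall 0 1, closedBall_mem_nhds _ one_pos, ?_⟩
  refine BoundedContinuousFunction.arzela_ascoli (closedBall 0 ‖ballLp μ r‖)
    (isCompact_closedBall _ _) _ ?_ ?_
  · rintro _ x ⟨f, hf, rfl⟩
    rw [mem_closedBall_zero_iff] at hf ⊢
    rw [avgBCF_apply, avg_eq_inner]
    refine (norm_inner_le_norm _ _).trans ?_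
    rw [LinearIsometryEquiv.norm_map]
    exact mul_le_of_le_one_right (norm_nonneg _) hf
  · intro x₀
    refine Metric.equicontinuousAt_of_continuity_modulus
      (fun x => ‖(rightRegular μ).toHom x₀⁻¹ (ballLp μ r) - (rightRegular μ).toHom x⁻¹ (ballLp μ r)‖)
      ?_ _ (Eventually.of_forall fun x i => ?_)
    · have := ((continuous_const (y := (rightRegular μ).toHom x₀⁻¹ (ballLp μ r))).sub
        (((rightRegular μ).continuous_toHom_apply (ballLp μ r)).comp continuous_inv)).norm.tendsto x₀
      simpa using this
    · obtain ⟨_, f, hf, rfl⟩ := i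
      rw [mem_closedBall_zero_iff] at hf
      change dist (avgBCF μ r f x₀) (avgBCF μ r f x) ≤ _
      rw [avgBCF_apply, avg_eq_inner, avgBCF_apply, avg_eq_inner, UnitaryRep.inner_toHom_right,
        UnitaryRep.inner_toHom_right, dist_eq_norm, ← inner_sub_left]
      exact (norm_inner_le_norm _ _).trans (mul_le_of_le_one_right (norm_nonneg _) hf)

/-- The kernel `P_r(y⁻¹x)` is real, bounded and symmetric in `x` and `y`, so Fubini applies. -/
theorem isSymmetric_avgOp : (avgOp μ r).IsSymmetric := by
  intro f g
  have hf : Integrable (fun y => conj (f y)) μ :=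
    (LinearIsometryEquiv.integrable_comp_iff (RCLike.conjLIE (K := ℂ))).2
      ((Lp.memLp f).integrable (by norm_num))
  have hg : Integrable g μ := (Lp.memLp g).integrable (by norm_num)
  have hint : Integrable (Function.uncurry fun x y =>
      ballDensity μ r (y⁻¹ * x) * (g x * conj (f y))) (μ.prod μ) := by
    refine (hg.mul_prod hf).bdd_mul
      ((measurable_ballDensity μ r).comp (by fun_prop : Measurable fun z : G × G =>
        z.2⁻¹ * z.1)).aestronglyMeasurable (Eventually.of_forall fun z => norm_ballDensity_le μ r _)
  calc inner ℂ (avgOp μ r f) g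
      = ∫ x, ∫ y, ballDensity μ r (y⁻¹ * x) * (g x * conj (f y)) ∂μ ∂μ := by
        rw [L2.inner_def]
        refine integral_congr_ae ?_
        filter_upwards [coeFn_avgOp μ r f] with x hx
        rw [hx, RCLike.inner_apply, avg, conv, ← integral_conj, ← integral_const_mul]
        refine integral_congr_ae (Eventually.of_forall fun y => ?_)
        simp only [map_mul, conj_ballDensity]
        ring
    _ = ∫ y, ∫ x, ballDensity μ r (y⁻¹ * x) * (g x * conj (f y)) ∂μ ∂μ :=
        integral_integral_swap hint
    _ = inner ℂ f (avgOp μ r g) := by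
        rw [L2.inner_def]
        refine integral_congr_ae ?_
        filter_upwards [coeFn_avgOp μ r g] with y hy
        rw [hy, RCLike.inner_apply, avg, conv, ← integral_mul_const]
        refine integral_congr_ae (Eventually.of_forall fun x => ?_)
        simp only
        rw [← ballDensity_inv μ r (y⁻¹ * x), mul_inv_rev, inv_inv]
        ring

/-- The densities `P_r` form an approximate identity; uniform continuity of `g` makes the
convergence uniform. -/
theorem tendsto_avgOp_toLp (g : C(G, ℂ)) :
    Tendsto (fun r => avgOp μ r (ContinuousMap.toLp 2 μ ℂ g)) (𝓝[>] 0)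
      (𝓝 (ContinuousMap.toLp 2 μ ℂ g)) := by
  rw [Metric.tendsto_nhds]
  intro ε hε
  obtain ⟨δ, hδ, hgδ⟩ := Metric.uniformContinuous_iff.1
    (CompactSpace.uniformContinuous_of_continuous g.continuous) (ε / 2) (half_pos hε)
  filter_upwards [Ioo_mem_nhdsGT hδ] with r hr
  rw [dist_eq_norm]
  refine lt_of_le_of_lt ?_ (half_lt_self hε)
  have key : ∀ᵐ x ∂μ, ‖(avgOp μ r (ContinuousMap.toLp 2 μ ℂ g) - ContinuousMap.toLp 2 μ ℂ g :
      Lp ℂ 2 μ) x‖ ≤ ε / 2 := by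
    filter_upwards [Lp.coeFn_sub (avgOp μ r (ContinuousMap.toLp 2 μ ℂ g))
      (ContinuousMap.toLp 2 μ ℂ g), coeFn_avgOp μ r (ContinuousMap.toLp 2 μ ℂ g),
      ContinuousMap.coeFn_toLp (p := 2) (𝕜 := ℂ) μ g] with x h1 h2 h3
    rw [h1, Pi.sub_apply, h2, h3, avg_congr_ae μ r (ContinuousMap.coeFn_toLp μ g),
      avg_eq_integral_mul_left]
    have hi : Integrable (fun z => g (x * z) * ballDensity μ r z) μ := by
      refine (integrable_ballDensity μ r).bdd_mul (c := ‖g‖)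
        (g.continuous.comp (continuous_const_mul x)).aestronglyMeasurable
        (Eventually.of_forall fun z => g.norm_coe_le_norm _)
    have : g x = ∫ z, g x * ballDensity μ r z ∂μ := by
      rw [integral_const_mul, integral_ballDensity μ hr.1, mul_one]
    rw [this, ← integral_sub hi ((integrable_ballDensity μ r).const_mul _)]
    calc _ ≤ ∫ z, ε / 2 * ‖ballDensity μ r z‖ ∂μ := by
          refine norm_integral_le_of_norm_le ((integrable_ballDensity μ r).norm.const_mul _)
            (Eventually.of_forall fun z => ?_)
          rw [← sub_mul, norm_mul]
          by_cases hz : z ∈ ball (1 : G) r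
          · gcongr
            rw [← dist_eq_norm]
            refine (hgδ ?_).le
            have : dist (x * z) (x * 1) < δ := by
              rw [dist_mul_left]
              exact (mem_ball.1 hz).trans hr.2
            simpa using this
          · simp [ballDensity, Set.indicator_of_notMem hz]
      _ = ε / 2 := by rw [integral_const_mul, integral_norm_ballDensity μ hr.1, mul_one]
  simpa [measureUnivNNReal] using Lp.norm_le_of_ae_bound (half_pos hε).le key

end Avg

/-! ### Schur's lemma and Schur orthogonality. -/

namespace UnitaryRep

section Schur

variable {G : Type*} [Group G] [TopologicalSpace G]
  {H : Type*} [NormedAddCommGroup H] [InnerProductSpace ℂ H] [FiniteDimensional ℂ H]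
  {K : Type*} [NormedAddCommGroup K] [InnerProductSpace ℂ K] [FiniteDimensional ℂ K]
  {π : UnitaryRep G H} {σ : UnitaryRep G K}

/-- Schur's lemma: intertwiners of irreducible representations of distinct dimensions vanish. -/
theorem IsIrreducible.eq_zero_of_intertwines (hπ : π.IsIrreducible) (hσ : σ.IsIrreducible)
    (hne : Module.finrank ℂ H ≠ Module.finrank ℂ K) {A : K →ₗ[ℂ] H}
    (hA : ∀ x v, π.toHom x (A v) = A (σ.toHom x v)) : A = 0 := by
  rcases hσ.2 (LinearMap.ker A) (Submodule.closed_of_finiteDimensional _) (fun x v hv => by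
    rw [LinearMap.mem_ker] at hv ⊢; rw [← hA, hv, map_zero]) with hk | hk
  · rcases hπ.2 (LinearMap.range A) (Submodule.closed_of_finiteDimensional _) (by
      rintro x _ ⟨v, rfl⟩; exact ⟨_, (hA x v).symm⟩) with hr | hr
    · exact LinearMap.range_eq_bot.1 hr
    · exact absurd (LinearEquiv.ofBijective A
        ⟨LinearMap.ker_eq_bot.1 hk, LinearMap.range_eq_top.1 hr⟩).finrank_eq hne.symm
  · exact LinearMap.ker_eq_top.1 hk

/-- Schur's lemma: self-intertwiners of an irreducible representation are scalars. -/
theorem IsIrreducible.exists_eq_smul_of_commutes (hπ : π.IsIrreducible) {A : H →ₗ[ℂ] H}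
    (hA : ∀ x v, π.toHom x (A v) = A (π.toHom x v)) : ∃ c : ℂ, ∀ v, A v = c • v := by
  have := hπ.1
  obtain ⟨c, hc⟩ := Module.End.exists_eigenvalue A
  refine ⟨c, ?_⟩
  rcases hπ.2 (Module.End.eigenspace A c) (Submodule.closed_of_finiteDimensional _)
    (fun x v hv => by
      rw [Module.End.mem_eigenspace_iff] at hv ⊢; rw [← hA, hv, map_smul]) with h | h
  · exact absurd h hc
  · intro v
    exact Module.End.mem_eigenspace_iff.1 (h ▸ Submodule.mem_top)

end Schur

section Integrals

variable {G : Type*} [Group G] [MetricSpace G] [IsTopologicalGroup G]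
  [CompactSpace G] [MeasurableSpace G] [BorelSpace G] (μ : Measure G) [μ.IsHaarMeasure]
  [IsProbabilityMeasure μ]
  {H : Type*} [NormedAddCommGroup H] [InnerProductSpace ℂ H] [FiniteDimensional ℂ H]
  {K : Type*} [NormedAddCommGroup K] [InnerProductSpace ℂ K] [FiniteDimensional ℂ K]
  (π : UnitaryRep G H) (σ : UnitaryRep G K)

theorem continuous_op : Continuous π.op :=
  continuous_clm_apply.2 π.continuous_toHom_apply

/-- The average over `G` of the maps `π(x)⁻¹ A σ(x)`. -/
def averageHom (A : K →L[ℂ] H) : K →L[ℂ] H :=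
  ∫ x, (π.op x⁻¹).comp (A.comp (σ.op x)) ∂μ

theorem continuous_conj_op (A : K →L[ℂ] H) :
    Continuous fun x => (π.op x⁻¹).comp (A.comp (σ.op x)) :=
  (π.continuous_op.comp continuous_inv).clm_comp (continuous_const.clm_comp σ.continuous_op)

theorem integrable_conj_op (A : K →L[ℂ] H) :
    Integrable (fun x => (π.op x⁻¹).comp (A.comp (σ.op x))) μ :=
  (π.continuous_conj_op σ A).integrable_of_hasCompactSupport (HasCompactSupport.of_compactSpace _)

theorem averageHom_apply (A : K →L[ℂ] H) (v : K) :
    averageHom μ π σ A v = ∫ x, π.toHom x⁻¹ (A (σ.toHom x v)) ∂μ :=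
  ContinuousLinearMap.integral_apply (integrable_conj_op μ π σ A) v

theorem inner_averageHom (A : K →L[ℂ] H) (w : H) (v : K) :
    inner ℂ w (averageHom μ π σ A v) = ∫ x, inner ℂ (π.toHom x w) (A (σ.toHom x v)) ∂μ := by
  rw [averageHom_apply, ← integral_inner]
  · simp_rw [inner_toHom_right, inv_inv]
  · exact (integrable_conj_op μ π σ A).apply_continuousLinearMap v

theorem toHom_averageHom [μ.IsMulRightInvariant] (A : K →L[ℂ] H) (y : G) (v : K) :
    π.toHom y (averageHom μ π σ A v) = averageHom μ π σ A (σ.toHom y v) := by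
  refine ext_inner_left ℂ fun w => ?_
  rw [inner_toHom_right, inner_averageHom, inner_averageHom,
    ← integral_mul_right_eq_self _ y]
  refine integral_congr_ae (Eventually.of_forall fun x => ?_)
  simp only [← toHom_mul_apply, mul_inv_cancel_right]

variable {π σ}

/-- Schur orthogonality for irreducible representations of distinct dimensions. -/
theorem IsIrreducible.integral_conj_coeff_mul_coeff_eq_zero [μ.IsMulRightInvariant]
    (hπ : π.IsIrreducible) (hσ : σ.IsIrreducible)
    (hne : Module.finrank ℂ H ≠ Module.finrank ℂ K) (v w : H) (v' w' : K) :
    ∫ x, inner ℂ (inner ℂ w (π.toHom x v)) (inner ℂ w' (σ.toHom x v')) ∂μ = 0 := by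
  -- The integral is a matrix entry of the average of a rank-one map, which intertwines `σ` and `π`
  -- and so vanishes.
  have h0 : (averageHom μ π σ (InnerProductSpace.rankOne ℂ w w') : K →ₗ[ℂ] H) = 0 :=
    hπ.eq_zero_of_intertwines hσ hne (toHom_averageHom μ π σ _)
  have h := inner_averageHom μ π σ (InnerProductSpace.rankOne ℂ w w') v v'
  rw [show averageHom μ π σ (InnerProductSpace.rankOne ℂ w w') v' = 0 from
    LinearMap.congr_fun h0 v', inner_zero_right] at h
  rw [h]
  refine integral_congr_ae (Eventually.of_forall fun x => ?_)
  simp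

/-- Schur orthogonality: the `L²` norm of a matrix coefficient. -/
theorem IsIrreducible.integral_norm_coeff_sq [μ.IsMulRightInvariant]
    (hπ : π.IsIrreducible) (v w : H) :
    ∫ x, ‖inner ℂ w (π.toHom x v)‖ ^ 2 ∂μ = ‖v‖ ^ 2 * ‖w‖ ^ 2 / Module.finrank ℂ H := by
  have := hπ.1
  have hn : (Module.finrank ℂ H : ℂ) ≠ 0 := by
    exact_mod_cast (Module.finrank_pos (R := ℂ) (M := H)).ne'
  set A : H →L[ℂ] H := InnerProductSpace.rankOne ℂ w w with hA
  obtain ⟨c, hc⟩ := hπ.exists_eq_smul_of_commutes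
    (A := (averageHom μ π π A : H →ₗ[ℂ] H)) (toHom_averageHom μ π π A)
  let tr : (H →L[ℂ] H) →L[ℂ] ℂ := LinearMap.toContinuousLinearMap
    ((LinearMap.trace ℂ H).comp (ContinuousLinearMap.coeLM ℂ))
  have htr : ∀ B : H →L[ℂ] H, tr B = LinearMap.trace ℂ H (B : H →ₗ[ℂ] H) := fun B => rfl
  -- The average of `A` is a scalar `c`. Conjugation preserves the trace, so `c · dim H = tr A =
  -- ‖w‖²`.
  have h1 : tr (averageHom μ π π A) = ‖w‖ ^ 2 := by
    rw [averageHom, ← ContinuousLinearMap.integral_comp_comm tr (integrable_conj_op μ π π A)]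
    have : ∀ x, tr ((π.op x⁻¹).comp (A.comp (π.op x))) = ‖w‖ ^ 2 := by
      intro x
      have hcomp : ((π.op x).comp (π.op x⁻¹)) = ContinuousLinearMap.id ℂ H := by
        rw [← op_mul, mul_inv_cancel, op_one]
      rw [htr, ContinuousLinearMap.toLinearMap_comp, LinearMap.trace_comp_comm',
        ← ContinuousLinearMap.toLinearMap_comp, ContinuousLinearMap.comp_assoc, hcomp,
        ContinuousLinearMap.comp_id, hA, InnerProductSpace.trace_rankOne,
        inner_self_eq_norm_sq_to_K]
      rfl
    simp [this]
  have h2 : tr (averageHom μ π π A) = c * Module.finrank ℂ H := by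
    have : (averageHom μ π π A : H →ₗ[ℂ] H) = c • LinearMap.id := LinearMap.ext hc
    rw [htr, this, map_smul, LinearMap.trace_id, smul_eq_mul]
  have h3 := inner_averageHom μ π π A v v
  rw [show averageHom μ π π A v = c • v from hc v, inner_smul_right,
    inner_self_eq_norm_sq_to_K] at h3
  have h4 : ∀ x, inner ℂ (π.toHom x v) (A (π.toHom x v))
      = ((‖inner ℂ w (π.toHom x v)‖ ^ 2 : ℝ) : ℂ) := by
    intro x
    rw [hA, InnerProductSpace.rankOne_apply, inner_smul_right, ← inner_conj_symm _ w,
      RCLike.mul_conj]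
    push_cast
    rfl
  simp_rw [h4] at h3
  have h5 : c = ‖w‖ ^ 2 / Module.finrank ℂ H := by
    rw [eq_div_iff hn, ← h2, h1]
  apply Complex.ofReal_injective
  rw [h5] at h3
  refine ((integral_ofReal (𝕜 := ℂ)).symm.trans h3.symm).trans ?_
  push_cast
  change _ * (‖v‖ : ℂ) ^ 2 = _
  ring

end Integrals

end UnitaryRep

/-! ### The scalar by which averaging acts on the coefficients of an irreducible representation. -/

section Eigen

variable {G : Type*} [Group G] [MetricSpace G] [IsTopologicalGroup G]
  [CompactSpace G] [MeasurableSpace G] [BorelSpace G] (μ : Measure G) [μ.IsHaarMeasure]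
  [IsProbabilityMeasure μ] [μ.IsMulRightInvariant] [IsIsometricSMul G G] [IsIsometricSMul Gᵐᵒᵖ G]
  {H : Type*} [NormedAddCommGroup H] [InnerProductSpace ℂ H] [FiniteDimensional ℂ H]
  {K : Type*} [NormedAddCommGroup K] [InnerProductSpace ℂ K] [FiniteDimensional ℂ K]
  {π : UnitaryRep G H} {σ : UnitaryRep G K} {r : ℝ}

theorem integrable_ballDensity_smul_op (π : UnitaryRep G H) (r : ℝ) :
    Integrable (fun z => ballDensity μ r z • π.op z) μ := by
  have hop : Integrable π.op μ :=
    π.continuous_op.integrable_of_hasCompactSupport (HasCompactSupport.of_compactSpace _)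
  exact hop.bdd_smul _ (measurable_ballDensity μ r).aestronglyMeasurable
    (Eventually.of_forall (norm_ballDensity_le μ r))

/-- The operator `∫ P_r(z) π(z) dz`. -/
def ballOp (π : UnitaryRep G H) (r : ℝ) : H →L[ℂ] H :=
  ∫ z, ballDensity μ r z • π.op z ∂μ

theorem inner_ballOp (π : UnitaryRep G H) (r : ℝ) (v w : H) :
    inner ℂ w (ballOp μ π r v) = ∫ z, ballDensity μ r z * inner ℂ w (π.toHom z v) ∂μ := by
  rw [ballOp, ContinuousLinearMap.integral_apply (integrable_ballDensity_smul_op μ π r),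
    ← integral_inner
      ((integrable_ballDensity_smul_op μ π r).apply_continuousLinearMap v)]
  refine integral_congr_ae (Eventually.of_forall fun z => ?_)
  simp [inner_smul_right, UnitaryRep.op_apply]

/-- `P_r` is conjugation invariant, so this operator is an intertwiner and Schur's lemma makes it a
scalar when `π` is irreducible. -/
theorem toHom_ballOp (π : UnitaryRep G H) (r : ℝ) (y : G) (v : H) :
    π.toHom y (ballOp μ π r v) = ballOp μ π r (π.toHom y v) := by
  refine ext_inner_left ℂ fun w => ?_
  rw [UnitaryRep.inner_toHom_right, inner_ballOp, inner_ballOp]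
  refine (integral_mul_left_eq_self _ y⁻¹).symm.trans
    (Eq.trans ?_ (integral_mul_right_eq_self _ y⁻¹))
  refine integral_congr_ae (Eventually.of_forall fun z => ?_)
  simp only [← UnitaryRep.toHom_mul_apply, inv_mul_cancel_right, ballDensity_mul_comm μ r y⁻¹,
    ← UnitaryRep.inner_toHom_right, mul_inv_cancel_left]

/-- The matrix coefficient `x ↦ ⟨w, π(x) v⟩` as an element of `L²(G)`. -/
def coeffLp (π : UnitaryRep G H) (v w : H) : Lp ℂ 2 μ :=
  ContinuousMap.toLp 2 μ ℂ
    ⟨fun x => inner ℂ w (π.toHom x v),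
      Continuous.inner (𝕜 := ℂ) continuous_const (π.continuous_toHom_apply v)⟩

theorem coeFn_coeffLp (π : UnitaryRep G H) (v w : H) :
    coeffLp μ π v w =ᵐ[μ] fun x => inner ℂ w (π.toHom x v) :=
  ContinuousMap.coeFn_toLp μ _

theorem UnitaryRep.IsIrreducible.norm_coeffLp_sq (hπ : π.IsIrreducible) (v w : H) :
    ‖coeffLp μ π v w‖ ^ 2 = ‖v‖ ^ 2 * ‖w‖ ^ 2 / Module.finrank ℂ H := by
  rw [← hπ.integral_norm_coeff_sq μ v w]
  apply Complex.ofReal_injective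
  rw [Complex.ofReal_pow]
  refine (inner_self_eq_norm_sq_to_K (𝕜 := ℂ) (coeffLp μ π v w)).symm.trans ?_
  rw [L2.inner_def]
  refine Eq.trans ?_ (integral_ofReal (𝕜 := ℂ))
  refine integral_congr_ae ?_
  filter_upwards [coeFn_coeffLp μ π v w] with x hx
  rw [hx, inner_self_eq_norm_sq_to_K]
  push_cast
  rfl

theorem avg_coeff (π : UnitaryRep G H) (v w : H) (x : G) :
    avg μ (fun x => inner ℂ w (π.toHom x v)) r x = inner ℂ w (π.toHom x (ballOp μ π r v)) := by
  rw [avg_eq_integral_mul_left, UnitaryRep.inner_toHom_right, inner_ballOp]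
  refine integral_congr_ae (Eventually.of_forall fun z => ?_)
  simp only [UnitaryRep.toHom_mul_apply]
  rw [UnitaryRep.inner_toHom_right, mul_comm]

/-- On the matrix coefficients of an irreducible `π`, convolution with `P_r` is a scalar, which is
close to `1` when `π` moves the ball of radius `r` little, and small when `dim π` is large. -/
theorem UnitaryRep.IsIrreducible.exists_coeffSpace_le_eigenspace (hπ : π.IsIrreducible)
    (hr : 0 < r) {κ : ℝ} (hκ₀ : 0 ≤ κ) (hκ : ∀ x : G, ‖π.op x - π.op 1‖ ≤ κ * dist x 1) :
    ∃ c : ℂ, ‖c - 1‖ ≤ κ * r ∧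
      ‖c‖ ^ 2 ≤ (μ.real (ball (1 : G) r) * Module.finrank ℂ H)⁻¹ ∧
      π.coeffSpace μ ≤ Module.End.eigenspace (avgOp μ r : Lp ℂ 2 μ →ₗ[ℂ] Lp ℂ 2 μ) c := by
  have := hπ.1
  obtain ⟨c, hc⟩ := hπ.exists_eq_smul_of_commutes (A := (ballOp μ π r : H →ₗ[ℂ] H))
    (toHom_ballOp μ π r)
  have hc' : ∀ v, ballOp μ π r v = c • v := hc
  refine ⟨c, ?_, ?_, ?_⟩
  -- As `P_r` has integral 1, `c - 1` is an average of `π(z) - π(1)` over the ball.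
  · have h1 : (c - 1) • ContinuousLinearMap.id ℂ H
        = ∫ z, ballDensity μ r z • (π.op z - π.op 1) ∂μ := by
      simp_rw [smul_sub]
      rw [integral_sub (integrable_ballDensity_smul_op μ π r)
        ((integrable_ballDensity μ r).smul_const _), integral_smul_const,
        integral_ballDensity μ hr, one_smul, sub_smul, one_smul, UnitaryRep.op_one]
      congr 1
      ext v
      exact (hc' v).symm
    calc ‖c - 1‖ = ‖(c - 1) • ContinuousLinearMap.id ℂ H‖ := by
          rw [norm_smul, ContinuousLinearMap.norm_id, mul_one]
      _ ≤ ∫ z, ‖ballDensity μ r z‖ * (κ * r) ∂μ := by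
          rw [h1]
          refine norm_integral_le_of_norm_le ((integrable_ballDensity μ r).norm.mul_const _)
            (Eventually.of_forall fun z => ?_)
          rw [norm_smul]
          by_cases hz : z ∈ ball (1 : G) r
          · gcongr
            exact (hκ z).trans (by gcongr; exact (mem_ball.1 hz).le)
          · simp [ballDensity, Set.indicator_of_notMem hz]
      _ = κ * r := by rw [integral_mul_const, integral_norm_ballDensity μ hr, one_mul]
  · obtain ⟨v, hv⟩ := exists_ne (0 : H)
    have hv' : 0 < ‖v‖ := norm_pos_iff.2 hv
    -- Pairing `P_r` with one diagonal coefficient computes `c`; Cauchy-Schwarz then brings in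
    -- `‖P_r‖₂² = 1 / |1_r|` and the factor `1 / dim H`.
    have h1 : c * (‖v‖ : ℂ) ^ 2 = inner ℂ (ballLp μ r) (coeffLp μ π v v) := by
      have h := inner_ballOp μ π r v v
      rw [hc', inner_smul_right, inner_self_eq_norm_sq_to_K] at h
      refine h.trans ?_
      rw [L2.inner_def]
      refine integral_congr_ae ?_
      filter_upwards [coeFn_ballLp μ r, coeFn_coeffLp μ π v v] with z h1 h2
      rw [h1, h2, RCLike.inner_apply, conj_ballDensity, mul_comm]
    have h2 : ‖c‖ * ‖v‖ ^ 2 ≤ ‖ballLp μ r‖ * ‖coeffLp μ π v v‖ := by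
      have := norm_inner_le_norm (𝕜 := ℂ) (ballLp μ r) (coeffLp μ π v v)
      rw [← h1] at this
      simpa using this
    have h3 : (‖c‖ * ‖v‖ ^ 2) ^ 2 ≤ (‖ballLp μ r‖ * ‖coeffLp μ π v v‖) ^ 2 := by gcongr
    rw [mul_pow, mul_pow, norm_ballLp_sq μ hr, hπ.norm_coeffLp_sq μ] at h3
    have h4 : (‖v‖ ^ 2) ^ 2 * ‖c‖ ^ 2 ≤ (‖v‖ ^ 2) ^ 2 *
        (μ.real (ball (1 : G) r) * Module.finrank ℂ H)⁻¹ := by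
      rw [mul_inv, mul_comm]
      refine h3.trans_eq ?_
      ring
    exact le_of_mul_le_mul_left h4 (by positivity)
  · refine Submodule.span_le.2 ?_
    rintro g ⟨v, w, hg⟩
    refine Module.End.mem_eigenspace_iff.2 (Lp.ext ?_)
    refine (coeFn_avgOp μ r g).trans ?_
    filter_upwards [Lp.coeFn_smul c g, hg] with x h1 h2
    rw [avg_congr_ae μ r hg, avg_coeff, hc', h1, Pi.smul_apply, h2, map_smul, inner_smul_right,
      smul_eq_mul]

/-- The coefficient spaces of irreducible representations of distinct dimensions are orthogonal. -/
theorem UnitaryRep.IsIrreducible.coeffSpace_isOrtho (hπ : π.IsIrreducible) (hσ : σ.IsIrreducible)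
    (hne : Module.finrank ℂ H ≠ Module.finrank ℂ K) : π.coeffSpace μ ⟂ σ.coeffSpace μ := by
  rw [UnitaryRep.coeffSpace, UnitaryRep.coeffSpace, Submodule.isOrtho_span]
  rintro f ⟨v, w, hf⟩ g ⟨v', w', hg⟩
  rw [L2.inner_def, ← hπ.integral_conj_coeff_mul_coeff_eq_zero μ hσ hne v w v' w']
  refine integral_congr_ae ?_
  filter_upwards [hf, hg] with x h1 h2
  rw [h1, h2]

end Eigen

/-! ### Irreducible subrepresentations and their models on Euclidean spaces. -/

namespace UnitaryRep

variable {G : Type*} [Group G] [TopologicalSpace G]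
  {H : Type*} [NormedAddCommGroup H] [InnerProductSpace ℂ H] (π : UnitaryRep G H)
  {K : Type*} [NormedAddCommGroup K] [InnerProductSpace ℂ K]

/-- The restriction of a unitary representation to an invariant subspace. -/
def restrict (W : Submodule ℂ H) (hW : ∀ x : G, ∀ v ∈ W, π.toHom x v ∈ W) : UnitaryRep G W where
  toHom :=
    { toFun := fun x =>
        { toFun := fun v => ⟨π.toHom x v, hW x v v.2⟩
          invFun := fun v => ⟨π.toHom x⁻¹ v, hW x⁻¹ v v.2⟩
          map_add' := fun v w => by ext; simp
          map_smul' := fun c v => by ext; simp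
          left_inv := fun v => by ext; simp
          right_inv := fun v => by ext; simp
          norm_map' := fun v => (π.toHom x).norm_map v }
      map_one' := by ext v; exact π.toHom_one_apply v
      map_mul' := fun x y => by ext v; exact π.toHom_mul_apply x y v }
  continuous_action := Continuous.subtype_mk (π.continuous_action.comp
    (by fun_prop : Continuous fun p : G × W => (p.1, (p.2 : H)))) _

/-- The transport of a unitary representation along an isometry. -/
def congr (e : H ≃ₗᵢ[ℂ] K) : UnitaryRep G K where
  toHom :=
    { toFun := fun x => (e.symm.trans (π.toHom x)).trans e
      map_one' := by ext v; simp
      map_mul' := fun x y => by ext v; simp }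
  continuous_action := e.continuous.comp (π.continuous_action.comp
    (by fun_prop : Continuous fun p : G × K => (p.1, e.symm p.2)))

theorem congr_apply (e : H ≃ₗᵢ[ℂ] K) (x : G) (v : K) :
    (π.congr e).toHom x v = e (π.toHom x (e.symm v)) := rfl

variable {π}

theorem IsIrreducible.congr (hπ : π.IsIrreducible) (e : H ≃ₗᵢ[ℂ] K) :
    (π.congr e).IsIrreducible := by
  have := hπ.1
  refine ⟨e.symm.toEquiv.nontrivial, fun W hW hinv => ?_⟩
  rcases hπ.2 (W.comap (e.toLinearEquiv : H →ₗ[ℂ] K)) (hW.preimage e.continuous)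
    (fun x v hv => by
      have := hinv x _ hv
      simpa [congr_apply] using this) with h | h
  · left
    refine (Submodule.eq_bot_iff _).2 fun v hv => ?_
    have : e.symm v ∈ W.comap (e.toLinearEquiv : H →ₗ[ℂ] K) := by simpa using hv
    rw [h, Submodule.mem_bot] at this
    simpa using this
  · right
    refine Submodule.eq_top_iff'.2 fun v => ?_
    have : e.symm v ∈ W.comap (e.toLinearEquiv : H →ₗ[ℂ] K) := h ▸ Submodule.mem_top
    simpa using this

theorem isIrreducible_restrict {W : Submodule ℂ H} (hW : ∀ x : G, ∀ v ∈ W, π.toHom x v ∈ W)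
    (hne : W ≠ ⊥) (hmin : ∀ U ≤ W, (∀ x : G, ∀ v ∈ U, π.toHom x v ∈ U) → U = ⊥ ∨ U = W) :
    (π.restrict W hW).IsIrreducible := by
  refine ⟨(Submodule.nontrivial_iff_ne_bot).2 hne, fun U _ hinv => ?_⟩
  rcases hmin (U.map W.subtype) (Submodule.map_subtype_le _ _) (by
    rintro x _ ⟨v, hv, rfl⟩
    exact ⟨_, hinv x v hv, rfl⟩) with h | h
  · exact Or.inl (Submodule.map_injective_of_injective W.injective_subtype
      (h.trans (Submodule.map_bot _).symm))
  · right
    apply Submodule.map_injective_of_injective W.injective_subtype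
    rw [h, Submodule.map_subtype_top]

/-- The matrix coefficients `⟨p, π(x) f⟩` with `f` in a minimal invariant subspace `W` of finite
dimension are matrix coefficients of an irreducible representation on a space in `Type`. -/
theorem exists_isIrreducible_of_minimal {W : Submodule ℂ H} [FiniteDimensional ℂ W]
    (hW : ∀ x : G, ∀ v ∈ W, π.toHom x v ∈ W) (hne : W ≠ ⊥)
    (hmin : ∀ U ≤ W, (∀ x : G, ∀ v ∈ U, π.toHom x v ∈ U) → U = ⊥ ∨ U = W) :
    ∃ (K : Type) (_ : NormedAddCommGroup K) (_ : InnerProductSpace ℂ K)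
      (_ : FiniteDimensional ℂ K) (σ : UnitaryRep G K), σ.IsIrreducible ∧
        ∀ p : H, ∀ f ∈ W, ∃ v w : K, ∀ x,
          inner ℂ p (π.toHom x f) = inner ℂ w (σ.toHom x v) := by
  -- Orthonormal coordinates move `W` to a Euclidean space in `Type`; only the projection of `p` to
  -- `W` affects the coefficient.
  let e := (stdOrthonormalBasis ℂ W).repr
  refine ⟨_, _, _, inferInstance, (π.restrict W hW).congr e,
    (isIrreducible_restrict hW hne hmin).congr e, fun p f hf =>
      ⟨e ⟨f, hf⟩, e (W.orthogonalProjectionOnto p), fun x => ?_⟩⟩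
  rw [congr_apply, LinearIsometryEquiv.inner_map_map, LinearIsometryEquiv.symm_apply_apply]
  exact (W.inner_orthogonalProjectionOnto_eq_of_mem_right ⟨π.toHom x f, hW x f hf⟩ p).symm

end UnitaryRep

/-! ### The Peter-Weyl theorem from the spectral theory of averaging. -/

section PeterWeyl

variable {G : Type*} [Group G] [MetricSpace G] [IsTopologicalGroup G]
  [CompactSpace G] [MeasurableSpace G] [BorelSpace G] (μ : Measure G) [μ.IsHaarMeasure]
  [IsProbabilityMeasure μ] [μ.IsMulRightInvariant] [IsIsometricSMul G G] [IsIsometricSMul Gᵐᵒᵖ G]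

theorem avgOp_rightRegular (r : ℝ) (x : G) (f : Lp ℂ 2 μ) :
    avgOp μ r ((rightRegular μ).toHom x f) = (rightRegular μ).toHom x (avgOp μ r f) := by
  refine Lp.ext ((coeFn_avgOp μ r _).trans ((coeFn_rightRegular μ x _).trans ?_).symm)
  filter_upwards [(measurePreserving_mul_right μ x).quasiMeasurePreserving.ae
    (coeFn_avgOp μ r f)] with y hy
  rw [hy, avg_eq_inner, avg_eq_inner, UnitaryRep.toHom_mul_apply]

theorem isClosed_dimSpace (I : Set ℝ) : IsClosed (dimSpace μ I : Set (Lp ℂ 2 μ)) :=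
  Submodule.isClosed_topologicalClosure _

theorem mem_dimSpace_of_mem_coeffSpace {H : Type} [NormedAddCommGroup H] [InnerProductSpace ℂ H]
    [FiniteDimensional ℂ H] {π : UnitaryRep G H} (hπ : π.IsIrreducible) {I : Set ℝ}
    (hI : (Module.finrank ℂ H : ℝ) ∈ I) {f : Lp ℂ 2 μ} (hf : f ∈ π.coeffSpace μ) :
    f ∈ dimSpace μ I := by
  unfold dimSpace
  refine Submodule.le_topologicalClosure _ (Submodule.subset_span ?_)
  exact ⟨H, inferInstance, inferInstance, inferInstance, π, hπ, hI, hf⟩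

/-- An eigenfunction with `c ≠ 0` satisfies `f = c⁻¹ f_r`, and `f_r` is a coefficient of the right
regular representation; minimality of `W` makes it a coefficient of an irreducible one. -/
theorem le_dimSpace_of_minimal {r : ℝ} {c : ℂ} (hc : c ≠ 0) {W : Submodule ℂ (Lp ℂ 2 μ)}
    [FiniteDimensional ℂ W]
    (hWc : W ≤ Module.End.eigenspace (avgOp μ r : Lp ℂ 2 μ →ₗ[ℂ] Lp ℂ 2 μ) c)
    (hW : ∀ x : G, ∀ v ∈ W, (rightRegular μ).toHom x v ∈ W) (hne : W ≠ ⊥)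
    (hmin : ∀ U ≤ W, (∀ x : G, ∀ v ∈ U, (rightRegular μ).toHom x v ∈ U) → U = ⊥ ∨ U = W) :
    W ≤ dimSpace μ Set.univ := by
  intro f hf
  obtain ⟨K, _, _, _, σ, hσ, hcoeff⟩ :=
    UnitaryRep.exists_isIrreducible_of_minimal hW hne hmin
  obtain ⟨v, w, hvw⟩ := hcoeff (conj c⁻¹ • ballLp μ r) f hf
  refine mem_dimSpace_of_mem_coeffSpace μ hσ (Set.mem_univ _)
    (Submodule.subset_span ⟨v, w, ?_⟩)
  have hT : f = c⁻¹ • avgOp μ r f := by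
    have := Module.End.mem_eigenspace_iff.1 (hWc hf)
    rw [ContinuousLinearMap.coe_coe] at this
    rw [this, inv_smul_smul₀ hc]
  have h1 : f =ᵐ[μ] (c⁻¹ • avgOp μ r f : Lp ℂ 2 μ) := by rw [← hT]
  refine h1.trans ?_
  filter_upwards [Lp.coeFn_smul c⁻¹ (avgOp μ r f), coeFn_avgOp μ r f] with x h2 h3
  rw [h2, Pi.smul_apply, h3, avg_eq_inner, ← hvw, inner_smul_left, Complex.conj_conj, smul_eq_mul]

/-- Complete reducibility by induction on dimension: a non-minimal `W` splits into an invariant `U`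
and its orthogonal complement in `W`, invariant by unitarity. -/
theorem le_dimSpace_of_le_eigenspace {r : ℝ} {c : ℂ} (hc : c ≠ 0) (n : ℕ) :
    ∀ W : Submodule ℂ (Lp ℂ 2 μ), FiniteDimensional ℂ W → Module.finrank ℂ W = n →
      W ≤ Module.End.eigenspace (avgOp μ r : Lp ℂ 2 μ →ₗ[ℂ] Lp ℂ 2 μ) c →
      (∀ x : G, ∀ v ∈ W, (rightRegular μ).toHom x v ∈ W) → W ≤ dimSpace μ Set.univ := by
  induction n using Nat.strong_induction_on with
  | _ n ih =>
    intro W hfin hn hWc hW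
    by_cases hne : W = ⊥
    · rw [hne]; exact bot_le
    by_cases hmin : ∀ U ≤ W, (∀ x : G, ∀ v ∈ U, (rightRegular μ).toHom x v ∈ U) → U = ⊥ ∨ U = W
    · exact le_dimSpace_of_minimal μ hc hWc hW hne hmin
    push Not at hmin
    obtain ⟨U, hUW, hU, hU0, hUne⟩ := hmin
    have hfinU : FiniteDimensional ℂ U := Submodule.finiteDimensional_of_le hUW
    have hsup : U ⊔ Uᗮ ⊓ W = W := Submodule.sup_orthogonal_inf_of_hasOrthogonalProjection hUW
    have hU'W : Uᗮ ⊓ W ≤ W := inf_le_right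
    have hU'ne : Uᗮ ⊓ W ≠ W := fun h => hU0 <| by
      have h1 : U ≤ Uᗮ := hUW.trans (inf_eq_right.1 h)
      have h2 := Submodule.inf_orthogonal_eq_bot U
      rwa [inf_eq_left.2 h1] at h2
    have hfinU' : FiniteDimensional ℂ ↥(Uᗮ ⊓ W) := Submodule.finiteDimensional_of_le hU'W
    rw [← hsup]
    refine sup_le ?_ ?_
    · exact ih _ (hn ▸ Submodule.finrank_lt_finrank_of_lt (lt_of_le_of_ne hUW hUne)) U hfinU rfl
        (hUW.trans hWc) hU
    · refine ih _ (hn ▸ Submodule.finrank_lt_finrank_of_lt (lt_of_le_of_ne hU'W hU'ne)) _ hfinU'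
        rfl (hU'W.trans hWc) fun x v hv => ⟨?_, hW x v hv.2⟩
      refine (Submodule.mem_orthogonal _ _).2 fun u hu => ?_
      rw [UnitaryRep.inner_toHom_right]
      exact (Submodule.mem_orthogonal _ _).1 hv.1 _ (hU x⁻¹ u hu)

/-- The eigenspaces of a compact self-adjoint operator span a dense subspace. The kernel contributes
nothing to the image, and the other eigenspaces are finite dimensional and translation invariant. -/
theorem avgOp_mem_dimSpace_univ (r : ℝ) (f : Lp ℂ 2 μ) : avgOp μ r f ∈ dimSpace μ Set.univ := by
  have hbot := ContinuousLinearMap.orthogonalComplement_iSup_eigenspaces_eq_bot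
    (isCompactOperator_avgOp μ r) (isSymmetric_avgOp μ r)
  rw [← Submodule.topologicalClosure_eq_top_iff] at hbot
  have hle : (⨆ c, Module.End.eigenspace (avgOp μ r : Lp ℂ 2 μ →ₗ[ℂ] Lp ℂ 2 μ) c) ≤
      (dimSpace μ Set.univ).comap (avgOp μ r : Lp ℂ 2 μ →ₗ[ℂ] Lp ℂ 2 μ) := by
    refine iSup_le fun c g hg => ?_
    have hgc := Module.End.mem_eigenspace_iff.1 hg
    rw [Submodule.mem_comap, hgc]
    rcases eq_or_ne c 0 with rfl | hc
    · simp
    refine Submodule.smul_mem _ _ ?_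
    refine le_dimSpace_of_le_eigenspace μ hc _ _
      (ContinuousLinearMap.finite_dimensional_eigenspace (isCompactOperator_avgOp μ r) c hc)
      rfl le_rfl (fun x v hv => ?_) hg
    rw [Module.End.mem_eigenspace_iff, ContinuousLinearMap.coe_coe] at hv ⊢
    rw [avgOp_rightRegular, hv, map_smul]
  have := Submodule.topologicalClosure_minimal _ hle
    ((isClosed_dimSpace μ Set.univ).preimage (avgOp μ r).continuous)
  exact this (hbot ▸ Submodule.mem_top : f ∈ _)

/-- The Peter-Weyl theorem, for a compact group with a bi-invariant metric. -/
theorem dimSpace_univ : dimSpace μ (Set.univ : Set ℝ) = ⊤ := by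
  have hdense := ContinuousMap.toLp_denseRange ℂ μ (p := 2) ℂ (by norm_num)
  rw [Submodule.eq_top_iff']
  intro f
  refine (isClosed_dimSpace μ Set.univ).closure_subset_iff.2 ?_ (hdense f)
  rintro _ ⟨g, rfl⟩
  exact (isClosed_dimSpace μ Set.univ).mem_of_tendsto (tendsto_avgOp_toLp μ g)
    (Eventually.of_forall fun r => avgOp_mem_dimSpace_univ μ r _)

end PeterWeyl

/-! ### Norm bounds for a symmetric operator from its eigenvalues. -/

section SymmetricOperators

variable {E : Type*} [NormedAddCommGroup E] [InnerProductSpace ℂ E] {T : E →L[ℂ] E}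

/-- Eigenspaces are orthogonal, so Pythagoras applies with `t c` the norm of the component in the
`c`-eigenspace. -/
theorem exists_norm_sq_eq_sum_of_mem_iSup_eigenspace (hT : T.IsSymmetric) {M : Set ℂ} {f : E}
    (hf : f ∈ ⨆ c : M, Module.End.eigenspace (T : E →ₗ[ℂ] E) (c : ℂ)) :
    ∃ (s : Finset M) (t : M → ℝ), ‖f‖ ^ 2 = ∑ c ∈ s, t c ^ 2 ∧
      ∀ d : ℂ, ‖T f - d • f‖ ^ 2 = ∑ c ∈ s, ‖(c : ℂ) - d‖ ^ 2 * t c ^ 2 := by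
  obtain ⟨l, hl, rfl⟩ := (Submodule.mem_iSup_iff_exists_finsupp _ _).1 hf
  have horth : OrthogonalFamily ℂ
      (fun c : M => Module.End.eigenspace (T : E →ₗ[ℂ] E) (c : ℂ)) fun c =>
        (Module.End.eigenspace (T : E →ₗ[ℂ] E) (c : ℂ)).subtypeₗᵢ :=
    (LinearMap.IsSymmetric.orthogonalFamily_eigenspaces (T := (T : E →ₗ[ℂ] E)) hT).comp
      Subtype.coe_injective
  refine ⟨l.support, fun c => ‖l c‖, ?_, fun d => ?_⟩
  · exact horth.norm_sum (fun c => ⟨l c, hl c⟩) l.support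
  · have h := horth.norm_sum (fun c => ⟨((c : ℂ) - d) • l c, Submodule.smul_mem _ _ (hl c)⟩)
      l.support
    simp only [Submodule.coe_subtypeₗᵢ, Submodule.subtype_apply, Submodule.coe_norm, norm_smul,
      mul_pow] at h
    rw [← h, Finsupp.sum, map_sum, Finset.smul_sum, ← Finset.sum_sub_distrib]
    congr 2
    refine Finset.sum_congr rfl fun c _ => ?_
    rw [sub_smul, ← Module.End.mem_eigenspace_iff.1 (hl c)]
    rfl

theorem norm_sub_smul_le_of_mem_closure (hT : T.IsSymmetric) {M : Set ℂ} {d : ℂ} {κ : ℝ}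
    (hκ : 0 ≤ κ) (hM : ∀ c ∈ M, ‖c - d‖ ≤ κ) {f : E}
    (hf : f ∈ (⨆ c : M, Module.End.eigenspace (T : E →ₗ[ℂ] E) (c : ℂ)).topologicalClosure) :
    ‖T f - d • f‖ ≤ κ * ‖f‖ := by
  have hcl : IsClosed {f : E | ‖T f - d • f‖ ≤ κ * ‖f‖} :=
    isClosed_le (by fun_prop) (by fun_prop)
  refine hcl.closure_subset_iff.2 (fun f hf => ?_) hf
  obtain ⟨s, t, h1, h2⟩ := exists_norm_sq_eq_sum_of_mem_iSup_eigenspace hT hf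
  refine (sq_le_sq₀ (norm_nonneg _) (by positivity)).1 ?_
  rw [mul_pow, h1, h2, Finset.mul_sum]
  gcongr with c
  exact hM c c.2

end SymmetricOperators

/-! ### Decomposition by dimension, and the inequality `1 ≤ L d₀`. -/

section DimSpace

variable {G : Type*} [Group G] [MetricSpace G] [IsTopologicalGroup G]
  [CompactSpace G] [MeasurableSpace G] [BorelSpace G] (μ : Measure G) [μ.IsHaarMeasure]
  [IsProbabilityMeasure μ] [μ.IsMulRightInvariant] [IsIsometricSMul G G] [IsIsometricSMul Gᵐᵒᵖ G]

theorem dimSpace_le_of_forall {I : Set ℝ} {V : Submodule ℂ (Lp ℂ 2 μ)}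
    (hV : IsClosed (V : Set (Lp ℂ 2 μ)))
    (h : ∀ (H : Type) [NormedAddCommGroup H] [InnerProductSpace ℂ H] [FiniteDimensional ℂ H]
      (π : UnitaryRep G H), π.IsIrreducible → (Module.finrank ℂ H : ℝ) ∈ I →
        π.coeffSpace μ ≤ V) : dimSpace μ I ≤ V := by
  unfold dimSpace
  refine Submodule.topologicalClosure_minimal _ (Submodule.span_le.2 ?_) hV
  rintro g ⟨H, _, _, _, π, hπ, hI, hg⟩
  exact h H π hπ hI hg

theorem coeffSpace_le_dimSpace {I : Set ℝ} {H : Type} [NormedAddCommGroup H]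
    [InnerProductSpace ℂ H] [FiniteDimensional ℂ H] {π : UnitaryRep G H} (hπ : π.IsIrreducible)
    (hI : (Module.finrank ℂ H : ℝ) ∈ I) : π.coeffSpace μ ≤ dimSpace μ I :=
  fun _ hf => mem_dimSpace_of_mem_coeffSpace μ hπ hI hf

/-- Sorting by dimension only needs Schur orthogonality between representations of distinct
dimensions. -/
theorem dimSpace_isOrtho {I J : Set ℝ} (hIJ : Disjoint I J) : dimSpace μ I ⟂ dimSpace μ J := by
  refine dimSpace_le_of_forall μ (Submodule.isClosed_orthogonal _) fun H _ _ _ π hπ hI => ?_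
  refine Submodule.IsOrtho.symm ?_
  refine dimSpace_le_of_forall μ (Submodule.isClosed_orthogonal _) fun K _ _ _ σ hσ hJ => ?_
  refine hσ.coeffSpace_isOrtho μ hπ fun h => ?_
  exact Set.disjoint_left.1 hIJ hI (by rwa [h] at hJ)

theorem iSup_dimSpace_orthogonal_eq_bot {I J K : Set ℝ} (h : I ∪ J ∪ K = Set.univ) :
    (dimSpace μ I ⊔ dimSpace μ J ⊔ dimSpace μ K)ᗮ = ⊥ := by
  rw [← Submodule.topologicalClosure_eq_top_iff, ← top_le_iff, ← dimSpace_univ μ]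
  refine dimSpace_le_of_forall μ (Submodule.isClosed_topologicalClosure _)
    fun H _ _ _ π hπ _ => ?_
  refine le_trans ?_ (Submodule.le_topologicalClosure _)
  rcases (h ▸ Set.mem_univ (Module.finrank ℂ H : ℝ) : _ ∈ I ∪ J ∪ K) with (hI | hJ) | hK
  · exact (coeffSpace_le_dimSpace μ hπ hI).trans (le_sup_left.trans le_sup_left)
  · exact (coeffSpace_le_dimSpace μ hπ hJ).trans (le_sup_right.trans le_sup_left)
  · exact (coeffSpace_le_dimSpace μ hπ hK).trans le_sup_right

variable {L C₀ C₁ d₀ : ℝ}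

theorem IsLocallyRandom.exists_coeffSpace_le_eigenspace (hG : IsLocallyRandom G L C₀) {r : ℝ}
    (hr : 0 < r) {H : Type} [NormedAddCommGroup H] [InnerProductSpace ℂ H] [FiniteDimensional ℂ H]
    {π : UnitaryRep G H} (hπ : π.IsIrreducible) :
    ∃ c : ℂ, ‖c - 1‖ ≤ C₀ * (Module.finrank ℂ H : ℝ) ^ L * r ∧
      ‖c‖ ^ 2 ≤ (μ.real (ball (1 : G) r) * Module.finrank ℂ H)⁻¹ ∧
      π.coeffSpace μ ≤ Module.End.eigenspace (avgOp μ r : Lp ℂ 2 μ →ₗ[ℂ] Lp ℂ 2 μ) c :=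
  hπ.exists_coeffSpace_le_eigenspace μ hr
    (mul_nonneg (zero_le_one.trans hG.one_le_coefficient) (by positivity))
    fun x => hG.norm_sub_le H π hπ x 1

theorem IsLocallyRandom.avgOp_mem_dimSpace (hG : IsLocallyRandom G L C₀) {r : ℝ}
    (hr : 0 < r) {I : Set ℝ} {f : Lp ℂ 2 μ} (hf : f ∈ dimSpace μ I) :
    avgOp μ r f ∈ dimSpace μ I := by
  suffices h : dimSpace μ I ≤ (dimSpace μ I).comap (avgOp μ r : Lp ℂ 2 μ →ₗ[ℂ] Lp ℂ 2 μ) from h hf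
  refine dimSpace_le_of_forall μ ((isClosed_dimSpace μ I).preimage (avgOp μ r).continuous)
    fun H _ _ _ π hπ hI g hg => ?_
  obtain ⟨c, -, -, hc⟩ := hG.exists_coeffSpace_le_eigenspace μ hr hπ
  rw [Submodule.mem_comap, Module.End.mem_eigenspace_iff.1 (hc hg)]
  exact Submodule.smul_mem _ _ (coeffSpace_le_dimSpace μ hπ hI hg)

/-- Reduces a norm estimate on `dimSpace` to placing each scalar in a set `M`, later a disc about
`1` or `0`. -/
theorem IsLocallyRandom.dimSpace_le_closure (hG : IsLocallyRandom G L C₀) {r : ℝ}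
    (hr : 0 < r) {I : Set ℝ} {M : Set ℂ}
    (hM : ∀ (H : Type) [NormedAddCommGroup H] [InnerProductSpace ℂ H] [FiniteDimensional ℂ H]
      (π : UnitaryRep G H), π.IsIrreducible → (Module.finrank ℂ H : ℝ) ∈ I → ∀ c : ℂ,
        ‖c - 1‖ ≤ C₀ * (Module.finrank ℂ H : ℝ) ^ L * r →
        ‖c‖ ^ 2 ≤ (μ.real (ball (1 : G) r) * Module.finrank ℂ H)⁻¹ → c ∈ M) :
    dimSpace μ I ≤ (⨆ c : M, Module.End.eigenspace
      (avgOp μ r : Lp ℂ 2 μ →ₗ[ℂ] Lp ℂ 2 μ) (c : ℂ)).topologicalClosure := by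
  refine dimSpace_le_of_forall μ (Submodule.isClosed_topologicalClosure _)
    fun H _ _ _ π hπ hI => ?_
  obtain ⟨c, h1, h2, hc⟩ := hG.exists_coeffSpace_le_eigenspace μ hr hπ
  refine (hc.trans ?_).trans (Submodule.le_topologicalClosure _)
  exact le_iSup (fun c : M => Module.End.eigenspace
    (avgOp μ r : Lp ℂ 2 μ →ₗ[ℂ] Lp ℂ 2 μ) (c : ℂ)) ⟨c, hM H π hπ hI c h1 h2⟩

/-- Averaging at the scale `r` moves functions of dimension at most `D` little. -/
theorem IsLocallyRandom.norm_avgOp_sub_le (hG : IsLocallyRandom G L C₀) {r κ : ℝ} (hr : 0 < r)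
    (hκ : 0 ≤ κ) {I : Set ℝ} (hI : ∀ n ∈ I, 1 ≤ n → C₀ * n ^ L * r ≤ κ) {f : Lp ℂ 2 μ}
    (hf : f ∈ dimSpace μ I) : ‖avgOp μ r f - f‖ ≤ κ * ‖f‖ := by
  have h := norm_sub_smul_le_of_mem_closure (isSymmetric_avgOp μ r) (d := 1)
    (M := {c | ‖c - 1‖ ≤ κ}) hκ (fun c hc => hc)
    (hG.dimSpace_le_closure μ hr (fun H _ _ _ π hπ hH c hc _ => by
      have := hπ.1
      exact hc.trans (hI _ hH (by exact_mod_cast Module.finrank_pos (R := ℂ) (M := H)))) hf)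
  rwa [one_smul] at h

/-- The bound does not depend on `s`, whereas `‖P_s‖₂ = |1_s|^(-1/2)` blows up as `s → 0` under the
dimension condition. -/
theorem norm_avgOp_ballLp_le {r s : ℝ} (hs : 0 < s) :
    ‖avgOp μ r (ballLp μ s)‖ ≤ (μ.real (ball (1 : G) r))⁻¹ := by
  have key : ∀ᵐ x ∂μ, ‖avgOp μ r (ballLp μ s) x‖ ≤ (μ.real (ball (1 : G) r))⁻¹ := by
    filter_upwards [coeFn_avgOp μ r (ballLp μ s)] with x hx
    rw [hx, avg_congr_ae μ r (coeFn_ballLp μ s), avg, conv]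
    calc _ ≤ ∫ y, ‖ballDensity μ s y‖ * (μ.real (ball (1 : G) r))⁻¹ ∂μ := by
          refine norm_integral_le_of_norm_le ((integrable_ballDensity μ s).norm.mul_const _)
            (Eventually.of_forall fun y => ?_)
          rw [norm_mul]
          gcongr
          exact norm_ballDensity_le μ r _
      _ = _ := by rw [integral_mul_const, integral_norm_ballDensity μ hs, one_mul]
  simpa [measureUnivNNReal] using Lp.norm_le_of_ae_bound (by positivity) key

/-- A locally random group of positive dimension has irreducible representations of arbitrarily
large dimension. -/
theorem IsLocallyRandom.exists_lt_finrank (hG : IsLocallyRandom G L C₀)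
    (hdim : DimensionCondition μ C₁ d₀) (N : ℝ) :
    ∃ (H : Type) (_ : NormedAddCommGroup H) (_ : InnerProductSpace ℂ H)
      (_ : FiniteDimensional ℂ H) (π : UnitaryRep G H),
      π.IsIrreducible ∧ N < Module.finrank ℂ H := by
  by_contra! hcon
  have hC₀ : 0 < C₀ := one_pos.trans_le hG.one_le_coefficient
  have hL : 0 ≤ L := zero_le_one.trans hG.one_le_exponent
  obtain ⟨N', hNN', hN'⟩ : ∃ N' : ℝ, N ≤ N' ∧ 0 < N' :=
    ⟨max N 1, le_max_left _ _, one_pos.trans_le (le_max_right _ _)⟩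
  set r : ℝ := (2 * (C₀ * N' ^ L))⁻¹ with hr_def
  have hr : 0 < r := by positivity
  have htop : dimSpace μ (Set.Iic N' : Set ℝ) = ⊤ := by
    rw [← top_le_iff, ← dimSpace_univ μ]
    refine dimSpace_le_of_forall μ (isClosed_dimSpace μ _) fun H _ _ _ π hπ _ => ?_
    exact coeffSpace_le_dimSpace μ hπ (Set.mem_Iic.2 ((hcon H _ _ inferInstance π hπ).trans hNN'))
  -- If all dimensions were at most `N'`, averaging at this one `r` would be bounded below on all of
  -- `L²`. The functions `P_s` contradict this as `s → 0`.
  have hhalf : ∀ f : Lp ℂ 2 μ, ‖f‖ ≤ 2 * ‖avgOp μ r f‖ := fun f => by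
    have h1 := hG.norm_avgOp_sub_le μ hr (κ := 1 / 2) (I := Set.Iic N') (by norm_num) (fun n hn hn1 => by
      have hn' : n ^ L ≤ N' ^ L := Real.rpow_le_rpow (by linarith) (Set.mem_Iic.1 hn) hL
      calc C₀ * n ^ L * r ≤ C₀ * N' ^ L * r := by gcongr
        _ = 1 / 2 := by rw [hr_def]; field_simp)
      (f := f) (by rw [htop]; exact Submodule.mem_top)
    have h2 := norm_sub_norm_le f (avgOp μ r f)
    rw [norm_sub_rev] at h1
    linarith
  set K : ℝ := 4 * ((μ.real (ball (1 : G) r))⁻¹) ^ 2 * C₁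
  have hK : ∀ᶠ s in 𝓝[>] (0 : ℝ), 1 ≤ K * s ^ d₀ := by
    filter_upwards [Ioo_mem_nhdsGT one_pos] with s hs
    have h1 := (hhalf (ballLp μ s)).trans
      (mul_le_mul_of_nonneg_left (norm_avgOp_ballLp_le μ hs.1 (r := r)) zero_le_two)
    have h2 : ‖ballLp μ s‖ ^ 2 ≤ (2 * (μ.real (ball (1 : G) r))⁻¹) ^ 2 := by gcongr
    rw [norm_ballLp_sq μ hs.1] at h2
    have hpos := measureReal_ball_one_pos μ hs.1
    have h3 := hdim.ball_le s hs.1 hs.2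
    calc (1 : ℝ) = (μ.real (ball (1 : G) s))⁻¹ * μ.real (ball (1 : G) s) :=
          (inv_mul_cancel₀ hpos.ne').symm
      _ ≤ (2 * (μ.real (ball (1 : G) r))⁻¹) ^ 2 * (C₁ * s ^ d₀) := by gcongr
      _ = K * s ^ d₀ := by ring
  have hlim : Tendsto (fun s : ℝ => K * s ^ d₀) (𝓝[>] 0) (𝓝 0) := by
    have := ((Real.continuous_rpow_const hdim.exponent_pos.le).const_mul K).tendsto 0
    rw [Real.zero_rpow hdim.exponent_pos.ne', mul_zero] at this
    exact this.mono_left nhdsWithin_le_nhds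
  exact absurd (ge_of_tendsto hlim hK) (by norm_num)

/-- At `r = (2 C₀ n^L)⁻¹` with `n = dim π`, the scalar has modulus at least `1/2`, yet its square is
at most a constant times `n^(L d₀ - 1)`. Letting `n → ∞` excludes `L d₀ < 1`. -/
theorem IsLocallyRandom.one_le_exponent_mul (hG : IsLocallyRandom G L C₀)
    (hdim : DimensionCondition μ C₁ d₀) : 1 ≤ L * d₀ := by
  by_contra! hlt
  have hC₀ : 0 < C₀ := one_pos.trans_le hG.one_le_coefficient
  have hC₁ : 0 < C₁ := one_pos.trans_le hdim.one_le_const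
  have hL : 0 < L := one_pos.trans_le hG.one_le_exponent
  set K : ℝ := C₁ * (2 * C₀) ^ d₀
  have hKpos : 0 < K := by positivity
  have hbound : ∀ N : ℝ, 1 ≤ N → 1 / 4 ≤ K * N ^ (-(1 - L * d₀)) := by
    intro N hN
    obtain ⟨H, _, _, _, π, hπ, hNn⟩ := hG.exists_lt_finrank μ hdim N
    set n : ℝ := (Module.finrank ℂ H : ℝ) with hn_def
    have hn1 : 1 ≤ n := hN.trans hNn.le
    have hn : 0 < n := one_pos.trans_le hn1
    set r : ℝ := (2 * C₀ * n ^ L)⁻¹ with hr_def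
    have hr : 0 < r := by positivity
    have hr1 : r < 1 := by
      apply inv_lt_one_of_one_lt₀
      have := Real.one_le_rpow hn1 hL.le
      nlinarith [hG.one_le_coefficient]
    obtain ⟨c, h1, h2, -⟩ := hG.exists_coeffSpace_le_eigenspace μ hr hπ
    rw [← hn_def] at h1 h2
    have h3 : C₀ * n ^ L * r = 1 / 2 := by rw [hr_def]; field_simp
    rw [h3] at h1
    have h4 : 1 / 2 ≤ ‖c‖ := by
      have := norm_sub_norm_le (1 : ℂ) c
      rw [norm_one, norm_sub_rev] at this
      linarith
    have h5 : (1 / 2 : ℝ) ^ 2 ≤ ‖c‖ ^ 2 := by gcongr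
    have hrpow : r ^ d₀ = ((2 * C₀) ^ d₀)⁻¹ * n ^ (-(L * d₀)) := by
      rw [hr_def, Real.inv_rpow (by positivity), Real.mul_rpow (by positivity) (by positivity),
        ← Real.rpow_mul hn.le, mul_inv, Real.rpow_neg hn.le]
    calc (1 / 4 : ℝ) ≤ (μ.real (ball (1 : G) r) * n)⁻¹ := by linarith
      _ ≤ (C₁⁻¹ * r ^ d₀ * n)⁻¹ := by
          gcongr
          exact hdim.le_ball r hr hr1
      _ = K * n ^ (-(1 - L * d₀)) := by
          have : n ^ (-(1 - L * d₀)) = (n * n ^ (-(L * d₀)))⁻¹ := by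
            rw [Real.rpow_neg hn.le, Real.rpow_sub hn, Real.rpow_one, Real.rpow_neg hn.le,
              div_eq_mul_inv]
          rw [hrpow, this]
          simp only [mul_inv, inv_inv]
          ring
      _ ≤ K * N ^ (-(1 - L * d₀)) := by
          gcongr ?_ * ?_
          exact Real.rpow_le_rpow_of_nonpos (by linarith) hNn.le (by linarith)
  have hlim := (tendsto_rpow_neg_atTop (sub_pos.2 hlt)).const_mul K
  rw [mul_zero] at hlim
  have := ge_of_tendsto hlim ((eventually_ge_atTop 1).mono hbound)
  norm_num at this

theorem livesAtScale_iff {a η : ℝ} (hη : 0 ≤ η) (f : Lp ℂ 2 μ) :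
    LivesAtScale μ a η f ↔ ‖avgOp μ (η ^ (1 / a)) f‖ ≤ η ^ (1 / (2 * a)) * ‖f‖ ∧
      ‖avgOp μ (η ^ (a ^ 2)) f - f‖ ≤ η ^ (a / 2) * ‖f‖ := by
  have h1 : eLpNorm (avg μ f (η ^ (1 / a))) 2 μ
      = ENNReal.ofReal ‖avgOp μ (η ^ (1 / a)) f‖ := by
    rw [← eLpNorm_congr_ae (coeFn_avgOp μ _ f), Lp.norm_def,
      ENNReal.ofReal_toReal (Lp.eLpNorm_ne_top _)]
  have h2 : eLpNorm (avg μ f (η ^ (a ^ 2)) - (f : G → ℂ)) 2 μ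
      = ENNReal.ofReal ‖avgOp μ (η ^ (a ^ 2)) f - f‖ := by
    rw [Lp.norm_def, ENNReal.ofReal_toReal (Lp.eLpNorm_ne_top _)]
    refine eLpNorm_congr_ae (((coeFn_avgOp μ _ f).symm.sub EventuallyEq.rfl).trans ?_)
    exact (Lp.coeFn_sub _ _).symm
  constructor
  · rintro ⟨h, h'⟩
    rw [h1, ENNReal.ofReal_le_ofReal_iff (by positivity)] at h
    rw [h2, ENNReal.ofReal_le_ofReal_iff (by positivity)] at h'
    exact ⟨h, h'⟩
  · rintro ⟨h, h'⟩
    exact ⟨h1 ▸ ENNReal.ofReal_le_ofReal h, h2 ▸ ENNReal.ofReal_le_ofReal h'⟩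

end DimSpace

/-! ### Comparison of scales with dimensions. -/

section Scales

variable {G : Type*} [Group G] [MetricSpace G] [IsTopologicalGroup G]
  [CompactSpace G] [MeasurableSpace G] [BorelSpace G] (μ : Measure G) [μ.IsHaarMeasure]
  [IsProbabilityMeasure μ] [μ.IsMulRightInvariant] [IsIsometricSMul G G] [IsIsometricSMul Gᵐᵒᵖ G]
  {L C₀ C₁ d₀ : ℝ}

/-- Averaging at the scale `r` shrinks functions of large dimension. -/
theorem IsLocallyRandom.norm_avgOp_le (hG : IsLocallyRandom G L C₀)
    (hdim : DimensionCondition μ C₁ d₀) {r κ : ℝ} (hr : 0 < r) (hr1 : r < 1)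
    (hκ : 0 ≤ κ) {I : Set ℝ} (hI : ∀ n ∈ I, 1 ≤ n → C₁ ≤ κ ^ 2 * (r ^ d₀ * n)) {f : Lp ℂ 2 μ}
    (hf : f ∈ dimSpace μ I) : ‖avgOp μ r f‖ ≤ κ * ‖f‖ := by
  have hC₁ : 0 < C₁ := one_pos.trans_le hdim.one_le_const
  have h := norm_sub_smul_le_of_mem_closure (isSymmetric_avgOp μ r) (d := 0)
    (M := {c | ‖c - 0‖ ≤ κ}) hκ (fun c hc => hc)
    (hG.dimSpace_le_closure μ hr (fun H _ _ _ π hπ hH c _ hc => by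
      have := hπ.1
      have hn : 1 ≤ (Module.finrank ℂ H : ℝ) := by
        exact_mod_cast Module.finrank_pos (R := ℂ) (M := H)
      have hn0 : 0 < (Module.finrank ℂ H : ℝ) := one_pos.trans_le hn
      rw [Set.mem_ofPred_eq, sub_zero, ← sq_le_sq₀ (norm_nonneg _) hκ]
      refine hc.trans ?_
      calc _ ≤ (C₁⁻¹ * r ^ d₀ * Module.finrank ℂ H)⁻¹ := by
            gcongr
            exact hdim.le_ball r hr hr1
        _ = C₁ / (r ^ d₀ * Module.finrank ℂ H) := by
            rw [mul_assoc, mul_inv, inv_inv, div_eq_mul_inv]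
        _ ≤ κ ^ 2 := by
            rw [div_le_iff₀ (by positivity)]
            exact hI _ hH hn) hf)
  simpa using h

theorem norm_sq_eq_add_of_isOrtho {E : Type*} [NormedAddCommGroup E] [InnerProductSpace ℂ E]
    {U V W : Submodule ℂ E} (hUV : U ⟂ V) (hUW : U ⟂ W) (hVW : V ⟂ W) {u v w : E} (hu : u ∈ U)
    (hv : v ∈ V) (hw : w ∈ W) : ‖u + v + w‖ ^ 2 = ‖u‖ ^ 2 + ‖v‖ ^ 2 + ‖w‖ ^ 2 := by
  have h1 := norm_add_sq_eq_norm_sq_add_norm_sq_of_inner_eq_zero (𝕜 := ℂ) (u + v) w (by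
    rw [inner_add_left, hUW.inner_eq hu hw, hVW.inner_eq hv hw, add_zero])
  have h2 := norm_add_sq_eq_norm_sq_add_norm_sq_of_inner_eq_zero (𝕜 := ℂ) u v
    (hUV.inner_eq hu hv)
  rw [sq, h1, h2]
  ring

theorem eq_starProjection_add {E : Type*} [NormedAddCommGroup E] [InnerProductSpace ℂ E]
    {U V W : Submodule ℂ E} [U.HasOrthogonalProjection] [V.HasOrthogonalProjection]
    [W.HasOrthogonalProjection] (hUV : U ⟂ V) (hUW : U ⟂ W) (hVW : V ⟂ W)
    (htop : (U ⊔ V ⊔ W)ᗮ = ⊥) (f : E) :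
    f = U.starProjection f + V.starProjection f + W.starProjection f := by
  rw [← sub_eq_zero, ← Submodule.mem_bot ℂ, ← htop, ← Submodule.inf_orthogonal,
    ← Submodule.inf_orthogonal]
  refine ⟨⟨?_, ?_⟩, ?_⟩
  · rw [show f - (U.starProjection f + V.starProjection f + W.starProjection f) =
      (f - U.starProjection f) - V.starProjection f - W.starProjection f by abel]
    exact sub_mem (sub_mem (U.sub_starProjection_mem_orthogonal f)
      (hUV.symm (V.starProjection_apply_mem f))) (hUW.symm (W.starProjection_apply_mem f))
  · rw [show f - (U.starProjection f + V.starProjection f + W.starProjection f) =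
      (f - V.starProjection f) - U.starProjection f - W.starProjection f by abel]
    exact sub_mem (sub_mem (V.sub_starProjection_mem_orthogonal f)
      (hUV (U.starProjection_apply_mem f))) (hVW.symm (W.starProjection_apply_mem f))
  · rw [show f - (U.starProjection f + V.starProjection f + W.starProjection f) =
      (f - W.starProjection f) - U.starProjection f - V.starProjection f by abel]
    exact sub_mem (sub_mem (W.sub_starProjection_mem_orthogonal f)
      (hUW (U.starProjection_apply_mem f))) (hVW (V.starProjection_apply_mem f))

/-- A function that averages to nearly zero at scale `r` and is nearly invariant at scale `s` is
concentrated on the dimensions between the two scales. -/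
theorem IsLocallyRandom.norm_sq_sub_le (hG : IsLocallyRandom G L C₀)
    (hdim : DimensionCondition μ C₁ d₀) {r s D U : ℝ} (hr : 0 < r)
    (hs : 0 < s) (hs1 : s < 1) (hD : 2 * C₀ * D ^ L * r ≤ 1) (hU : 2 * C₁ ≤ s ^ d₀ * U)
    (f : Lp ℂ 2 μ) :
    ‖f‖ ^ 2 - 4 * ‖avgOp μ r f‖ ^ 2 - 16 * ‖avgOp μ s f - f‖ ^ 2 ≤
      ‖dimProj μ (Set.Icc D U) f‖ ^ 2 := by
  have hC₀ : 0 < C₀ := one_pos.trans_le hG.one_le_coefficient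
  have hL : 0 ≤ L := zero_le_one.trans hG.one_le_exponent
  set A := dimSpace μ (Set.Iio D : Set ℝ)
  set B := dimSpace μ (Set.Icc D U : Set ℝ)
  -- Intersecting with `Set.Ici D` keeps the three sets disjoint even when `U < D`.
  set C := dimSpace μ (Set.Ici D ∩ Set.Ioi U : Set ℝ)
  have hAB : A ⟂ B := dimSpace_isOrtho μ (Set.disjoint_left.2 fun x hx hx' =>
    not_le_of_gt (Set.mem_Iio.1 hx) hx'.1)
  have hAC : A ⟂ C := dimSpace_isOrtho μ (Set.disjoint_left.2 fun x hx hx' =>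
    not_le_of_gt (Set.mem_Iio.1 hx) (Set.mem_Ici.1 hx'.1))
  have hBC : B ⟂ C := dimSpace_isOrtho μ (Set.disjoint_left.2 fun x hx hx' =>
    not_le_of_gt (Set.mem_Ioi.1 hx'.2) hx.2)
  have htop : (A ⊔ B ⊔ C)ᗮ = ⊥ := iSup_dimSpace_orthogonal_eq_bot μ <| by
    ext x
    simp only [Set.mem_union, Set.mem_Iio, Set.mem_Icc, Set.mem_inter_iff, Set.mem_Ici,
      Set.mem_Ioi, Set.mem_univ, iff_true]
    grind
  have hf := eq_starProjection_add hAB hAC hBC htop f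
  have hu : A.starProjection f ∈ A := A.starProjection_apply_mem f
  have hv : B.starProjection f ∈ B := B.starProjection_apply_mem f
  have hw : C.starProjection f ∈ C := C.starProjection_apply_mem f
  change _ ≤ ‖B.starProjection f‖ ^ 2
  set u := A.starProjection f
  set v := B.starProjection f
  set w := C.starProjection f
  have hnorm : ‖f‖ ^ 2 = ‖u‖ ^ 2 + ‖v‖ ^ 2 + ‖w‖ ^ 2 := by
    rw [hf]; exact norm_sq_eq_add_of_isOrtho hAB hAC hBC hu hv hw
  have hlow : ‖u‖ ≤ 2 * ‖avgOp μ r u‖ := by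
    have h1 := hG.norm_avgOp_sub_le μ hr (κ := 1 / 2) (by norm_num) (fun n hn hn1 => by
      have : n ^ L ≤ D ^ L := Real.rpow_le_rpow (by linarith) (le_of_lt hn) hL
      have : C₀ * n ^ L * r ≤ C₀ * D ^ L * r := by gcongr
      linarith) hu
    have h2 := norm_sub_norm_le u (avgOp μ r u)
    rw [norm_sub_rev] at h1
    linarith
  -- Here `|c|² ≤ 1/2 ≤ (3/4)²`, so `‖w‖ - ‖w_s‖ ≥ ‖w‖ / 4`.
  have hhigh : ‖w‖ ≤ 4 * ‖avgOp μ s w - w‖ := by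
    have h1 := hG.norm_avgOp_le μ hdim hs hs1 (κ := 3 / 4) (by norm_num) (fun n hn hn1 => by
      have hsd : 0 < s ^ d₀ := by positivity
      have : s ^ d₀ * U ≤ s ^ d₀ * n := by gcongr; exact le_of_lt hn.2
      have := hdim.one_le_const
      nlinarith) hw
    have h2 := norm_sub_norm_le w (avgOp μ s w)
    rw [norm_sub_rev] at h2
    linarith
  -- Averaging preserves each of the three orthogonal pieces, so its effect on one piece is bounded
  -- by its effect on `f`.
  have hr' : ‖avgOp μ r u‖ ^ 2 ≤ ‖avgOp μ r f‖ ^ 2 := by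
    have h : ‖avgOp μ r f‖ ^ 2 =
        ‖avgOp μ r u‖ ^ 2 + ‖avgOp μ r v‖ ^ 2 + ‖avgOp μ r w‖ ^ 2 := by
      conv_lhs => rw [hf, map_add, map_add]
      exact norm_sq_eq_add_of_isOrtho hAB hAC hBC (hG.avgOp_mem_dimSpace μ hr hu)
        (hG.avgOp_mem_dimSpace μ hr hv) (hG.avgOp_mem_dimSpace μ hr hw)
    rw [h]
    nlinarith [sq_nonneg ‖avgOp μ r v‖, sq_nonneg ‖avgOp μ r w‖]
  have hs' : ‖avgOp μ s w - w‖ ^ 2 ≤ ‖avgOp μ s f - f‖ ^ 2 := by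
    have h : ‖avgOp μ s f - f‖ ^ 2 =
        ‖avgOp μ s u - u‖ ^ 2 + ‖avgOp μ s v - v‖ ^ 2 + ‖avgOp μ s w - w‖ ^ 2 := by
      conv_lhs =>
        rw [hf, map_add, map_add, add_sub_add_comm, add_sub_add_comm]
      exact norm_sq_eq_add_of_isOrtho hAB hAC hBC
        (sub_mem (hG.avgOp_mem_dimSpace μ hs hu) hu)
        (sub_mem (hG.avgOp_mem_dimSpace μ hs hv) hv)
        (sub_mem (hG.avgOp_mem_dimSpace μ hs hw) hw)
    rw [h]
    nlinarith [sq_nonneg ‖avgOp μ s v - v‖, sq_nonneg ‖avgOp μ s u - u‖]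
  have h1 : ‖u‖ ^ 2 ≤ (2 * ‖avgOp μ r u‖) ^ 2 := by gcongr
  have h2 : ‖w‖ ^ 2 ≤ (4 * ‖avgOp μ s w - w‖) ^ 2 := by gcongr
  nlinarith

theorem IsLocallyRandom.le_norm_dimProj_sq (hG : IsLocallyRandom G L C₀)
    (hdim : DimensionCondition μ C₁ d₀) {a : ℝ} (ha : 4 * L * d₀ ≤ a) {η : ℝ} (hη₀ : 0 < η)
    (hη₁ : η < 1) {f : Lp ℂ 2 μ} (hf : LivesAtScale μ a η f) :
    (1 - 8 * η ^ (1 / (2 * a))) * ‖f‖ ^ 2 ≤ ‖dimProj μ (Set.Icc (1 / (2 * C₀) *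
      η ^ (-(1 / (L * a)))) (2 * C₁ * η ^ (-(d₀ * a ^ 2)))) f‖ ^ 2 := by
  have hC₀ : 0 < C₀ := one_pos.trans_le hG.one_le_coefficient
  have hC₁ : 0 < C₁ := one_pos.trans_le hdim.one_le_const
  have hL : 0 < L := one_pos.trans_le hG.one_le_exponent
  have ha4 : 4 ≤ a := by linarith [hG.one_le_exponent_mul μ hdim]
  have ha0 : 0 < a := by linarith
  set t := η ^ (1 / (2 * a)) with ht_def
  have ht0 : 0 < t := by positivity
  -- For `8t ≥ 1` the left side is nonpositive. Otherwise the total loss is `4t² + 16t² = 20t² ≤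
  -- (5/2) t ≤ 8t`, times `‖f‖²`.
  rcases le_or_gt 1 (8 * t) with ht | ht
  · exact (mul_nonpos_of_nonpos_of_nonneg (by linarith) (by positivity)).trans (by positivity)
  rw [livesAtScale_iff μ hη₀.le] at hf
  refine le_trans ?_ (hG.norm_sq_sub_le μ hdim (r := η ^ (1 / a)) (s := η ^ (a ^ 2))
    (by positivity) (by positivity) (Real.rpow_lt_one hη₀.le hη₁ (by positivity)) ?_ ?_ f)
  · have h1 : ‖avgOp μ (η ^ (1 / a)) f‖ ^ 2 ≤ (t * ‖f‖) ^ 2 := by gcongr; exact hf.1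
    have h3 : η ^ (a / 2) ≤ t :=
      Real.rpow_le_rpow_of_exponent_ge hη₀ hη₁.le (by
        rw [div_le_div_iff₀ (by positivity) two_pos]
        nlinarith)
    have h2 : ‖avgOp μ (η ^ (a ^ 2)) f - f‖ ^ 2 ≤ (t * ‖f‖) ^ 2 := by
      gcongr
      exact hf.2.trans (by gcongr)
    have h4 : t * t * ‖f‖ ^ 2 ≤ 1 / 8 * t * ‖f‖ ^ 2 := by gcongr; linarith
    nlinarith [mul_nonneg ht0.le (sq_nonneg ‖f‖)]
  · have e1 : (η ^ (-(1 / (L * a)))) ^ L = (η ^ (1 / a))⁻¹ := by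
      rw [← Real.rpow_mul hη₀.le, ← Real.rpow_neg hη₀.le]
      congr 1
      field_simp
    -- Uses both `C₀ ≥ 1` and `L ≥ 1`; this is why the lower endpoint can carry `1 / (2 C₀)` without
    -- an `L`-th root.
    have e2 : (1 / (2 * C₀)) ^ L ≤ 1 / (2 * C₀) := by
      refine Real.rpow_le_self_of_le_one (by positivity) ?_ hG.one_le_exponent
      rw [div_le_one (by positivity)]
      linarith [hG.one_le_coefficient]
    rw [Real.mul_rpow (by positivity) (by positivity), e1]
    calc _ ≤ 2 * C₀ * (1 / (2 * C₀) * (η ^ (1 / a))⁻¹) * η ^ (1 / a) := by gcongr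
      _ = 1 := by
        have : 0 < η ^ (1 / a) := by positivity
        field_simp
  · have e : (η ^ (a ^ 2)) ^ d₀ * η ^ (-(d₀ * a ^ 2)) = 1 := by
      rw [← Real.rpow_mul hη₀.le, ← Real.rpow_add hη₀]
      ring_nf
      exact Real.rpow_zero η
    refine le_of_eq ?_
    linear_combination (-(2 * C₁)) * e

/-- The endpoints are where the two scalar bounds meet the definition: `1/a + d₀/a - (d₀+1)/a = 0`
for the lower one, and `(-2a² + a)/2 + a² = a/2` for the upper one. -/
theorem IsLocallyRandom.livesAtScale (hG : IsLocallyRandom G L C₀)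
    (hdim : DimensionCondition μ C₁ d₀) {a : ℝ} (ha : 0 < a) {η : ℝ} (hη₀ : 0 < η)
    (hη₁ : η < 1) {f : Lp ℂ 2 μ} (hf : f ∈ dimSpace μ (Set.Icc (C₁ * η ^ (-((d₀ + 1) / a)))
      (C₀ ^ (-1 / L) * η ^ ((-2 * a ^ 2 + a) / (2 * L))))) : LivesAtScale μ a η f := by
  have hC₀ : 0 < C₀ := one_pos.trans_le hG.one_le_coefficient
  have hC₁ : 0 < C₁ := one_pos.trans_le hdim.one_le_const
  have hL : 0 < L := one_pos.trans_le hG.one_le_exponent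
  rw [livesAtScale_iff μ hη₀.le]
  constructor
  · refine hG.norm_avgOp_le μ hdim (by positivity) (Real.rpow_lt_one hη₀.le hη₁ (by positivity))
      (by positivity) (fun n hn _ => ?_) hf
    have e : (η ^ (1 / (2 * a))) ^ 2 * ((η ^ (1 / a)) ^ d₀ * η ^ (-((d₀ + 1) / a))) = 1 := by
      rw [← Real.rpow_natCast, ← Real.rpow_mul hη₀.le, ← Real.rpow_mul hη₀.le,
        ← Real.rpow_add hη₀, ← Real.rpow_add hη₀]
      refine Eq.trans (congrArg _ ?_) (Real.rpow_zero η)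
      push_cast
      field_simp
      ring
    calc C₁ = (η ^ (1 / (2 * a))) ^ 2 * ((η ^ (1 / a)) ^ d₀ *
          (C₁ * η ^ (-((d₀ + 1) / a)))) := by linear_combination (-C₁) * e
      _ ≤ _ := by gcongr; exact hn.1
  · refine hG.norm_avgOp_sub_le μ (by positivity) (by positivity) (fun n hn hn1 => ?_) hf
    have hn0 : 0 ≤ n := by linarith
    have e1 : (C₀ ^ (-1 / L)) ^ L = C₀⁻¹ := by
      rw [← Real.rpow_mul hC₀.le, div_mul_cancel₀ _ hL.ne', Real.rpow_neg_one]
    have e2 : (η ^ ((-2 * a ^ 2 + a) / (2 * L))) ^ L * η ^ (a ^ 2) = η ^ (a / 2) := by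
      rw [← Real.rpow_mul hη₀.le, ← Real.rpow_add hη₀]
      congr 1
      field_simp
      ring
    calc C₀ * n ^ L * η ^ (a ^ 2)
        ≤ C₀ * (C₀ ^ (-1 / L) * η ^ ((-2 * a ^ 2 + a) / (2 * L))) ^ L * η ^ (a ^ 2) := by
          gcongr; exact hn.2
      _ = η ^ (a / 2) := by
          rw [Real.mul_rpow (by positivity) (by positivity), e1, ← e2]
          field_simp

end Scales

end LocRand

end

theorem mainTheorem9 {G : Type*} [Group G] [MetricSpace G] [IsTopologicalGroup G]
    [CompactSpace G] [MeasurableSpace G] [BorelSpace G]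
    (μ : MeasureTheory.Measure G) [μ.IsHaarMeasure] [MeasureTheory.IsProbabilityMeasure μ]
    (L C₀ C₁ d₀ a : ℝ)
    (hG : LocRand.IsLocallyRandom G L C₀)
    (hdim : LocRand.DimensionCondition μ C₁ d₀)
    (ha : 4 * L * d₀ ≤ a)
    (η : ℝ) (hη₀ : 0 < η) (hη₁ : η < 1) :
    (∀ f : MeasureTheory.Lp ℂ 2 μ, LocRand.LivesAtScale μ a η f →
      (1 - 8 * η ^ (1 / (2 * a))) * ‖f‖ ^ 2 ≤
        ‖LocRand.dimProj μ
          (Set.Icc (1 / (2 * C₀) * η ^ (-(1 / (L * a)))) (2 * C₁ * η ^ (-(d₀ * a ^ 2)))) f‖ ^ 2) ∧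
    (∀ f ∈ LocRand.dimSpace μ
        (Set.Icc (C₁ * η ^ (-((d₀ + 1) / a))) (C₀ ^ (-1 / L) * η ^ ((-2 * a ^ 2 + a) / (2 * L)))),
      LocRand.LivesAtScale μ a η f) := by
  have : μ.IsMulRightInvariant := LocRand.isMulRightInvariant_of_isProbabilityMeasure μ
  have : IsIsometricSMul G G := ⟨fun g => Isometry.of_dist_eq (hG.dist_left g)⟩
  have : IsIsometricSMul Gᵐᵒᵖ G :=
    ⟨fun g => Isometry.of_dist_eq fun x y => hG.dist_right g.unop x y⟩
  have hL : 0 < L := one_pos.trans_le hG.one_le_exponent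
  have ha₀ : 0 < a :=
    lt_of_lt_of_le (mul_pos (mul_pos four_pos hL) hdim.exponent_pos) ha
  exact ⟨fun f hf => hG.le_norm_dimProj_sq μ hdim ha hη₀ hη₁ hf,
    fun f hf => hG.livesAtScale μ hdim ha₀ hη₀ hη₁ hf⟩
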